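/- \textbf{Setting.} Let $T>0$, let $U\subset\mathbb R^m$ be compact and connected (and nonempty), let $\xi\in\mathbb R^n$, and let $f:[0,T]\times\mathbb R^n\times\mathbb R^m\to\mathbb R^n$ and $\Psi:\mathbb R^n\to\mathbb R$ be such that $\Psi$, $\nabla\Psi$, $f$, $\partial f/\partial x$ and $\partial f/\partial u$ exist and are Lipschitz continuous with a common constant $L>0$ (for $f$ and its derivatives: on $[0,T]\times\mathbb R^n\times U$, jointly in $(t,x,u)$). A relaxed input is a measurable family $\mu=(\mu_t)_{t\in[0,T]}$ of Borel probability measures on $\mathbb R^m$ with $\operatorname{supp}\mu_t\subset U$ for a.e. $t$. Its trajectory $x^{(\mu)}$ solves $x(0)=\xi$, $\dot x(t)=\int f(t,x(t),u)\,d\mu_t(u)$, and the costate $p$ of a pair $(x,\mu)$ solves $p(T)=\nabla\Psi(x(T))$, $\dot p(t)=-\int \frac{\partial f}{\partial x}(t,x(t),u)^{\top}d\mu_t(u)\,p(t)$. The relaxed problem $\mathbf P$ is to minimize $\Psi(x(T))$ over the set $\mathcal D$ of all pairs $(x^{(\mu)},\mu)$. Pairs $(x,\mu)$ carry the product of the topology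 of uniform convergence of $x\in C([0,T],\mathbb R^n)$ and the weak topology of relaxed inputs ($\mu^N\to\mu$ iff $\int_0^T\!\int\varphi(t,u)\,d\mu^N_t(u)\,dt\to\int_0^T\!\int\varphi(t,u)\,d\mu_t(u)\,dt$ for all bounded continuous $\varphi$). A variation of $\mu$ is a measurable family $\delta\mu=(\delta\mu_t)$ of signed measures with $\delta\mu_t+\mu_t\ge0$ and $\int d\delta\mu_t=0$ for a.e. $t$. Put $$\theta_h(x,\mu)=\inf_{\delta\mu}\int_0^T p(t)^{\top}\!\int f(t,x(t),u)\,d\delta\mu_t(u)\,dt\quad\text{subject to } \operatorname{supp}(\delta\mu_t+\mu_t)\subset U\ \text{for a.e. } t .$$ For each $N$ let $u_{N,1},\dots,u_{N,N}$ be independent random points with common law $\nu$, a probability distribution whose support is $U$ (for instance the uniform distribution on $U$, whenever every nonempty relatively open subset of $U$ has positive volume); nothing is assumed about the dependence between different $N$. Let $\mathcal D_N$ be the set of pairs $(x^{(\mu)},\mu)\in\mathcal D$ with $\mu_t=\sum_{i=1}^N w_i(t)\,\delta_{u_{N,i}}$ for a.e. $t$, where the $w_i$ are measurable, $w_i\ge0$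 and $\sum_i w_i=1$, and let $\mathbf P_N$ be the problem of minimizing $\Psi(x(T))$ over $\mathcal D_N$. On $\mathcal D_N$ let $\theta_{N,h}$ be defined by the same formula as $\theta_h$, with the constraint $\operatorname{supp}(\delta\mu_t+\mu_t)\subset U$ replaced by $\operatorname{supp}(\delta\mu_t)\subset\operatorname{supp}(\mu_t)$, and let $\hat\theta_{N,h}$ be defined with $\operatorname{supp}(\delta\mu_t)\subset\{u_{N,1},\dots,u_{N,N}\}$ instead (the two agree when all weights are positive). Functions $F_N:\mathcal D_N\to\mathbb R$ epi-converge to $F:\mathcal D\to\mathbb R$ if (a) each $y\in\mathcal D$ is the limit of points $y_N\in\mathcal D_N$ ($N$ large) with $\limsup_N F_N(y_N)\le F(y)$; and (b) whenever $y_j\in\mathcal D_{N_j}$, $N_1<N_2<\cdots$ and $y_j\to y$, then $y\in\mathcal D$ and $\liminf_j F_{N_j}(y_j)\ge F(y)$. A function $\theta$ with values in $(-\infty,0]$ on the feasible set is an optimality function of a problem if it vanishes at every minimizer. \textbf{Theorem.} Every relaxed input has a unique trajectory, and every pair $(x,\mu)$, with $x$ continuous, has a unique costate. With probability one the following hold as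 $N\to\infty$: \begin{enumerate} \item $\theta_{N,h}$ epi-converges to $\theta_h$; \item $\hat\theta_{N,h}$ epi-converges to $\theta_h$; \item $(\mathbf P_N,\hat\theta_{N,h})$ are consistent approximations of $(\mathbf P,\theta_h)$ in Polak's sense: $\hat\theta_{N,h}$ and $\theta_h$ are optimality functions of $\mathbf P_N$ (for every $N$) and of $\mathbf P$; the costs of $\mathbf P_N$ epi-converge to the cost of $\mathbf P$; and $\limsup_j\hat\theta_{N_j,h}(y_j)\le\theta_h(y)$ whenever $y_j\in\mathcal D_{N_j}$, $N_1<N_2<\cdots$ and $y_j\to y$. \end{enumerate} -/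

import Mathlib

open MeasureTheory ProbabilityTheory Filter Topology

noncomputable section

/-- The Euclidean space `ℝⁿ`. -/
abbrev RVec (n : ℕ) := EuclideanSpace ℝ (Fin n)

/-! ### Epi-convergence and consistent approximations -/

/-- Epi-convergence of the constrained problems `min {F N y | y ∈ D N}` to the constrained problem
`min {F' y | y ∈ D'}`: every point of `D'` has a recovery sequence, and the lower bound (together
with feasibility of the limit) holds along every convergent subsequence of feasible points. -/
structure EpiConverges {Y : Type*} [TopologicalSpace Y]
    (D : ℕ → Set Y) (F : ℕ → Y → EReal) (D' : Set Y) (F' : Y → EReal) : Prop where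
  recovery : ∀ y ∈ D', ∃ a : ℕ → Y, (∀ᶠ N in atTop, a N ∈ D N) ∧ Tendsto a atTop (𝓝 y) ∧
    limsup (fun N => F N (a N)) atTop ≤ F' y
  lower : ∀ (k : ℕ → ℕ), StrictMono k → ∀ (a : ℕ → Y) (y : Y), (∀ j, a j ∈ D (k j)) →
    Tendsto a atTop (𝓝 y) → y ∈ D' ∧ F' y ≤ liminf (fun j => F (k j) (a j)) atTop

/-- `θ : D → (-∞, 0]` is an optimality function for `min {F y | y ∈ D}`: it vanishes at every
minimizer. -/
structure IsOptimalityFunction {Y : Type*} (D : Set Y) (F θ : Y → EReal) : Prop where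
  nonpos : ∀ y ∈ D, θ y ≤ 0
  ne_bot : ∀ y ∈ D, θ y ≠ ⊥
  eq_zero : ∀ y ∈ D, IsMinOn F D y → θ y = 0

/-- Consistent approximations: the pairs of problems `min {F N y | y ∈ D N}` and optimality
functions `θ N` are consistent approximations to the pair of `min {F' y | y ∈ D'}` and `θ'`. -/
structure ConsistentApproximations {Y : Type*} [TopologicalSpace Y]
    (D : ℕ → Set Y) (F θ : ℕ → Y → EReal) (D' : Set Y) (F' θ' : Y → EReal) : Prop where
  optimality_approx : ∀ N, IsOptimalityFunction (D N) (F N) (θ N)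
  optimality_limit : IsOptimalityFunction D' F' θ'
  epi : EpiConverges D F D' F'
  upper : ∀ (k : ℕ → ℕ), StrictMono k → ∀ (a : ℕ → Y) (y : Y), (∀ j, a j ∈ D (k j)) →
    Tendsto a atTop (𝓝 y) → limsup (fun j => θ (k j) (a j)) atTop ≤ θ' y

/-! ### Signed measures -/

/-- The support of a signed measure, that is, of its total variation. -/
def signedSupport {m : ℕ} (δ : SignedMeasure (RVec m)) : Set (RVec m) :=
  δ.totalVariation.support

/-- The integral `∫ g dδ = ∫ g dδ⁺ - ∫ g dδ⁻` with respect to a signed measure. -/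
def signedIntegral {m n : ℕ} (δ : SignedMeasure (RVec m)) (g : RVec m → RVec n) : RVec n :=
  (∫ u, g u ∂δ.toJordanDecomposition.posPart) - ∫ u, g u ∂δ.toJordanDecomposition.negPart

/-! ### The relaxed optimal control problem -/

/-- The data of the control problem on `[0, T]` with dynamics `ẋ = f (t, x, u)`, initial point `ξ`,
input set `U` and final cost `Ψ`. -/
structure ControlProblem (n m : ℕ) where
  T : ℝ
  T_pos : 0 < T
  U : Set (RVec m)
  isCompact_U : IsCompact U
  isConnected_U : IsConnected U
  ξ : RVec n
  f : ℝ → RVec n → RVec m → RVec n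
  Ψ : RVec n → ℝ

namespace ControlProblem

variable {n m : ℕ} (P : ControlProblem n m)

/-- The vector field and the final cost are Lipschitz continuously differentiable. -/
def LipschitzC1 : Prop :=
  Differentiable ℝ P.Ψ ∧
  (∀ t ∈ Set.Icc 0 P.T, ∀ x, ∀ u ∈ P.U,
    DifferentiableAt ℝ (fun y => P.f t y u) x ∧ DifferentiableAt ℝ (fun v => P.f t x v) u) ∧
  ∃ L : ℝ, 0 < L ∧
    (∀ x₁ x₂, |P.Ψ x₁ - P.Ψ x₂| ≤ L * ‖x₁ - x₂‖) ∧
    (∀ x₁ x₂, ‖fderiv ℝ P.Ψ x₁ - fderiv ℝ P.Ψ x₂‖ ≤ L * ‖x₁ - x₂‖) ∧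
    ∀ t₁ ∈ Set.Icc 0 P.T, ∀ t₂ ∈ Set.Icc 0 P.T, ∀ x₁ x₂, ∀ u₁ ∈ P.U, ∀ u₂ ∈ P.U,
      ‖P.f t₁ x₁ u₁ - P.f t₂ x₂ u₂‖ ≤ L * (|t₁ - t₂| + ‖x₁ - x₂‖ + ‖u₁ - u₂‖) ∧
      ‖fderiv ℝ (fun y => P.f t₁ y u₁) x₁ - fderiv ℝ (fun y => P.f t₂ y u₂) x₂‖
        ≤ L * (|t₁ - t₂| + ‖x₁ - x₂‖ + ‖u₁ - u₂‖) ∧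
      ‖fderiv ℝ (fun v => P.f t₁ x₁ v) u₁ - fderiv ℝ (fun v => P.f t₂ x₂ v) u₂‖
        ≤ L * (|t₁ - t₂| + ‖x₁ - x₂‖ + ‖u₁ - u₂‖)

/-- The time interval `[0, T]`, carrying Lebesgue measure. -/
abbrev Time : Type := Set.Icc (0 : ℝ) P.T

instance : MeasureSpace P.Time := Measure.Subtype.measureSpace

instance : IsFiniteMeasure (volume : Measure P.Time) := by
  have : IsFiniteMeasureOnCompacts (volume : Measure P.Time) :=
    IsFiniteMeasureOnCompacts.comap' volume continuous_subtype_val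
      (MeasurableEmbedding.subtype_coe measurableSet_Icc)
  infer_instance

/-- The final time `T`. -/
def finalTime : P.Time := ⟨P.T, P.T_pos.le, le_rfl⟩

/-- A relaxed input: a measurable family `t ↦ μ t` of Borel probability measures on `ℝᵐ` with
`supp (μ t) ⊆ U` for almost every `t`. -/
structure RelaxedInput where
  kernel : Kernel P.Time (RVec m)
  isMarkov : IsMarkovKernel kernel
  support_subset : ∀ᵐ t, (kernel t).support ⊆ P.U

attribute [instance] RelaxedInput.isMarkov

variable {P}

/-- The finite measure `dt ⊗ μ t (du)` on `[0, T] × ℝᵐ`. -/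
def RelaxedInput.toFiniteMeasure (μ : P.RelaxedInput) : FiniteMeasure (P.Time × RVec m) :=
  ⟨(volume : Measure P.Time) ⊗ₘ μ.kernel, inferInstance⟩

/-- The weak topology of relaxed inputs: `μ_N → μ` iff
`∫ ∫ φ (t, u) dμ_{N, t} (u) dt → ∫ ∫ φ (t, u) dμ_t (u) dt` for each bounded continuous `φ`. -/
instance : TopologicalSpace P.RelaxedInput :=
  TopologicalSpace.induced RelaxedInput.toFiniteMeasure inferInstance

variable (P)

/-- Pairs of a state curve and a relaxed input, with uniform convergence of the state curves and
weak convergence of the relaxed inputs. -/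
abbrev Pair : Type := C(P.Time, RVec n) × P.RelaxedInput

/-- `x` is the trajectory of the relaxed input `μ`:
`x 0 = ξ` and `ẋ t = ∫ f (t, x t, u) dμ_t (u)`, in integrated form. -/
def IsTrajectory (x : C(P.Time, RVec n)) (μ : P.RelaxedInput) : Prop :=
  ∀ t, x t = P.ξ + ∫ s in Set.Iic t, ∫ u, P.f s (x s) u ∂(μ.kernel s)

/-- `p` is the costate of the pair: `p T = ∇Ψ (x T)` and
`ṗ t = - (∫ ∂f/∂x (t, x t, u)ᵀ dμ_t (u)) p t`, in integrated form. -/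
def IsCostate (y : P.Pair) (p : C(P.Time, RVec n)) : Prop :=
  ∀ t, p t = gradient P.Ψ (y.1 P.finalTime) + ∫ s in Set.Ici t,
    (∫ u, ContinuousLinearMap.adjoint (fderiv ℝ (fun z => P.f s z u) (y.1 s)) ∂(y.2.kernel s)) (p s)

/-- The costate of a pair. -/
def costate (y : P.Pair) : C(P.Time, RVec n) := Classical.epsilon (P.IsCostate y)

/-- The Hamiltonian `H (t, x, δ, p) = pᵀ ∫ f (t, x, u) dδ (u)`. -/
def hamiltonian (t : P.Time) (x : RVec n) (δ : SignedMeasure (RVec m)) (p : RVec n) : ℝ :=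
  inner ℝ p (signedIntegral δ (P.f t x))

/-- The variations common to all optimality functions: measurable families `δ` of signed measures
with `δ t + μ t ≥ 0` and `∫ dδ t = 0` for almost every `t`. -/
structure IsVariation (μ : P.RelaxedInput) (δ : P.Time → SignedMeasure (RVec m)) : Prop where
  measurable : ∀ B, MeasurableSet B → Measurable fun t => δ t B
  nonneg : ∀ᵐ t, 0 ≤ δ t + (μ.kernel t).toSignedMeasure
  mass_zero : ∀ᵐ t, δ t Set.univ = 0

/-- The optimal value of `∫ H (t, x t, δ t, p t) dt` over the variations `δ` of `μ` that satisfy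
the constraint `C`. -/
def hamiltonianValue (y : P.Pair) (C : (P.Time → SignedMeasure (RVec m)) → Prop) : EReal :=
  ⨅ (δ : P.Time → SignedMeasure (RVec m)) (_ : P.IsVariation y.2 δ ∧ C δ),
    ((∫ t, P.hamiltonian t (y.1 t) (δ t) (P.costate y t) : ℝ) : EReal)

/-- The optimality function `θ_h`: `supp (δ t + μ t) ⊆ U`. -/
def thetaH (y : P.Pair) : EReal :=
  P.hamiltonianValue y fun δ =>
    ∀ᵐ t, signedSupport (δ t + (y.2.kernel t).toSignedMeasure) ⊆ P.U

/-- The discretized optimality function `θ_{N,h}`: `supp (δ t) ⊆ supp (μ t)`. -/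
def thetaNH (y : P.Pair) : EReal :=
  P.hamiltonianValue y fun δ => ∀ᵐ t, signedSupport (δ t) ⊆ (y.2.kernel t).support

/-- The discretized optimality function whose variations are carried by the sample points `v i`:
`supp (δ t) ⊆ {v i}`. It agrees with `thetaNH` where the support of `μ t` consists of all the
sample points. -/
def thetaSample {N : ℕ} (v : Fin N → RVec m) (y : P.Pair) : EReal :=
  P.hamiltonianValue y fun δ => ∀ᵐ t, signedSupport (δ t) ⊆ Set.range v

/-- The relaxed input is empirical on the samples `v`: `μ t = ∑ i, w i t • dirac (v i)` with
measurable weights `w i t ≥ 0` that sum to one. -/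
def IsEmpirical {N : ℕ} (v : Fin N → RVec m) (μ : P.RelaxedInput) : Prop :=
  ∃ w : Fin N → P.Time → ℝ, (∀ i, Measurable (w i)) ∧ (∀ i t, 0 ≤ w i t) ∧
    (∀ t, ∑ i, w i t = 1) ∧
    ∀ᵐ t, μ.kernel t = ∑ i, ENNReal.ofReal (w i t) • Measure.dirac (v i)

/-- The feasible set of the relaxed problem: the pairs `(x^(μ), μ)`. -/
def relaxedPairs : Set P.Pair := {y | P.IsTrajectory y.1 y.2}

/-- The feasible set of the sampled problem: the pairs `(x^(μ), μ)` with `μ` empirical. -/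
def empiricalPairs {N : ℕ} (v : Fin N → RVec m) : Set P.Pair :=
  {y | P.IsTrajectory y.1 y.2 ∧ P.IsEmpirical v y.2}

/-- The cost `Ψ (x T)`. -/
def cost (y : P.Pair) : EReal := (P.Ψ (y.1 P.finalTime) : EReal)

end ControlProblem

end

/-! The optimality functions become infima of one functional. A variation of `μ` is, up to null
sets, a difference `μ' - μ` of relaxed inputs. Its Hamiltonian integral is `descent F y μ'`, which
is the derivative of the cost at `y` along the segment from `μ` to `μ'`. So `thetaH y` is the
infimum of `descent F y` over all relaxed inputs, and on empirical pairs `thetaSample v y` is its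
infimum over the inputs that are empirical on `v`.

Three facts then suffice. Trajectory and costate depend continuously on the pair: weak convergence
of inputs makes primitives of averages converge uniformly, and Grönwall does the rest. Hence
`descent F (a j)` tends to `descent F y` uniformly in the direction (`exists_abs_descent_sub_le`),
which gives lower semicontinuity of `thetaH`. Almost surely the samples become dense in `U`, by
Borel–Cantelli. Moving each input to its nearest samples then shows that every relaxed input is a
weak limit of empirical ones (`exists_empirical_tendsto`), so `thetaSample` satisfies the upper
bound along every convergent sequence of empirical pairs.

For `thetaNH` that bound can fail: at a Dirac-valued input it is zero. Epi-convergence only asks for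
one recovery sequence, and this is taken with full support on the samples, where `thetaNH ≤
thetaSample`. The lower bounds hold because both discretized functions dominate `thetaH`. Finally,
segments between feasible inputs stay feasible, so at a minimizer no directional derivative is
negative, and both infima vanish. -/

noncomputable section

/-! ### Integral equations of Volterra type -/

section Volterra

variable {X : Type*} [TopologicalSpace X] [MeasurableSpace X]
  {E : Type*} [NormedAddCommGroup E] [NormedSpace ℝ E]

/-- A continuously varying family of sets `I t` along which integral equations
`z t = c + ∫ s in I t, a s (z s)` are well posed: for each rate `K` there is a weight growing at
least at that rate along the family. -/
structure IsVolterra (vol : Measure X) (I : X → Set X) : Prop where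
  measurableSet : ∀ t, MeasurableSet (I t)
  tendsto_symmDiff : ∀ t₀, Tendsto (fun t => vol.real (symmDiff (I t) (I t₀))) (𝓝 t₀) (𝓝 0)
  exists_weight : ∀ K : ℝ, 0 < K → ∃ e : C(X, ℝ), (∀ t, 0 < e t) ∧
    ∀ t, ∫ s in I t, e s ∂vol ≤ e t / K

theorem norm_setIntegral_sub_setIntegral_le {X : Type*} [MeasurableSpace X] {E : Type*}
    [NormedAddCommGroup E] [NormedSpace ℝ E] {vol : Measure X} [IsFiniteMeasure vol] {A B : Set X}
    (hA : MeasurableSet A) (hB : MeasurableSet B) {g : X → E} {C : ℝ} (hg : Integrable g vol)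
    (hC : ∀ᵐ s ∂vol, ‖g s‖ ≤ C) :
    ‖(∫ s in A, g s ∂vol) - ∫ s in B, g s ∂vol‖ ≤ C * vol.real (symmDiff A B) := by
  rw [← integral_indicator hA, ← integral_indicator hB,
    ← integral_sub (hg.indicator hA) (hg.indicator hB)]
  have hAB : MeasurableSet (symmDiff A B) := hA.symmDiff hB
  calc _ ≤ ∫ s, (symmDiff A B).indicator (fun _ => C) s ∂vol := by
        refine norm_integral_le_of_norm_le ((integrable_const C).indicator hAB) ?_
        filter_upwards [hC] with s hs
        by_cases h1 : s ∈ A <;> by_cases h2 : s ∈ B <;>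
          simp [Set.indicator, Set.mem_symmDiff, h1, h2, hs]
    _ = _ := by
        rw [integral_indicator hAB, setIntegral_const, smul_eq_mul, mul_comm]

variable {vol : Measure X} [IsFiniteMeasure vol] {I : X → Set X}

theorem IsVolterra.continuous_setIntegral (hI : IsVolterra vol I) {g : X → E} {C : ℝ}
    (hg : Integrable g vol) (hC : ∀ᵐ s ∂vol, ‖g s‖ ≤ C) :
    Continuous fun t => ∫ s in I t, g s ∂vol := by
  rw [continuous_iff_continuousAt]
  intro t₀
  rw [ContinuousAt, tendsto_iff_norm_sub_tendsto_zero]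
  refine squeeze_zero (fun _ => norm_nonneg _) (fun t => norm_setIntegral_sub_setIntegral_le
    (hI.measurableSet t) (hI.measurableSet t₀) hg hC) ?_
  simpa using (hI.tendsto_symmDiff t₀).const_mul C

variable [CompactSpace X] [OpensMeasurableSpace X]

theorem ContinuousMap.integrable_of_compactSpace (d : C(X, ℝ)) (vol : Measure X)
    [IsFiniteMeasure vol] : Integrable d vol :=
  (integrable_const ‖d‖).mono' d.continuous.measurable.aestronglyMeasurable
    (.of_forall fun s => d.norm_coe_le_norm s)

variable [Nonempty X]

/-- Grönwall's inequality. -/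
theorem IsVolterra.gronwall (hI : IsVolterra vol I) {L : ℝ} (hL : 0 < L) :
    ∃ C : ℝ, 0 ≤ C ∧ ∀ (d : C(X, ℝ)) (ε : ℝ), 0 ≤ ε → (∀ t, 0 ≤ d t) →
      (∀ t, d t ≤ ε + L * ∫ s in I t, d s ∂vol) → ∀ t, d t ≤ C * ε := by
  -- With rate `2 * L` one has `L * ∫ s in I t, e s ≤ e t / 2`. At a maximum of `d / e` the integral
  -- term therefore absorbs at most half of `d`, which leaves `d ≤ 2 * ε` there.
  obtain ⟨e, he, heI⟩ := hI.exists_weight (2 * L) (by positivity)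
  obtain ⟨t₁, ht₁⟩ := e.continuous.exists_forall_le_of_hasCompactSupport
    (HasCompactSupport.of_compactSpace _)
  obtain ⟨t₂, ht₂⟩ := e.continuous.exists_forall_ge_of_hasCompactSupport
    (HasCompactSupport.of_compactSpace _)
  refine ⟨2 * e t₂ / e t₁, by have := he t₁; have := he t₂; positivity, ?_⟩
  intro d ε hε hd h t
  have hq : Continuous fun t => d t / e t :=
    d.continuous.div e.continuous fun t => (he t).ne'
  obtain ⟨s, hs⟩ := hq.exists_forall_ge_of_hasCompactSupport
    (HasCompactSupport.of_compactSpace _)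
  set M := d s / e s with hM
  have hM0 : 0 ≤ M := div_nonneg (hd s) (he s).le
  have hdM : ∀ r, d r ≤ M * e r := fun r => (div_le_iff₀ (he r)).1 (hs r)
  have h1 : ∫ r in I s, d r ∂vol ≤ M * (e s / (2 * L)) := by
    calc _ ≤ ∫ r in I s, M * e r ∂vol := by
          refine integral_mono (d.integrable_of_compactSpace vol).integrableOn
            ((e.integrable_of_compactSpace vol).const_mul M).integrableOn hdM
      _ = M * ∫ r in I s, e r ∂vol := integral_const_mul _ _
      _ ≤ _ := mul_le_mul_of_nonneg_left (heI s) hM0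
  have h2 : d s ≤ ε + M * e s / 2 := by
    have h3 := h s
    have h4 := mul_le_mul_of_nonneg_left h1 hL.le
    have h5 : L * (M * (e s / (2 * L))) = M * e s / 2 := by field_simp
    linarith
  have h3 : M * e s = d s := div_mul_cancel₀ _ (he s).ne'
  have h4 : M * e t₁ ≤ 2 * ε := by
    have := mul_le_mul_of_nonneg_left (ht₁ s) hM0
    linarith
  calc d t ≤ M * e t := hdM t
    _ ≤ M * e t₂ := mul_le_mul_of_nonneg_left (ht₂ t) hM0
    _ ≤ (2 * ε / e t₁) * e t₂ :=
        mul_le_mul_of_nonneg_right ((le_div_iff₀ (he t₁)).2 h4) (he t₂).le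
    _ = _ := by ring

/-- Lipschitz integral equations have a unique continuous solution. -/
theorem IsVolterra.existsUnique [CompleteSpace E] (hI : IsVolterra vol I) {L B : ℝ} (hL : 0 < L)
    (c : E) {a : X → E → E}
    (hmeas : ∀ z : C(X, E), AEStronglyMeasurable (fun s => a s (z s)) vol)
    (hlip : ∀ᵐ s ∂vol, ∀ z z', ‖a s z - a s z'‖ ≤ L * ‖z - z'‖)
    (hbd : ∀ᵐ s ∂vol, ‖a s 0‖ ≤ B) :
    ∃! z : C(X, E), ∀ t, z t = c + ∫ s in I t, a s (z s) ∂vol := by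
  have hb : ∀ z : C(X, E), ∀ᵐ s ∂vol, ‖a s (z s)‖ ≤ B + L * ‖z‖ := by
    intro z
    filter_upwards [hlip, hbd] with s h1 h2
    have h3 := h1 (z s) 0
    rw [sub_zero] at h3
    have h4 := mul_le_mul_of_nonneg_left (z.norm_coe_le_norm s) hL.le
    calc ‖a s (z s)‖ = ‖a s 0 + (a s (z s) - a s 0)‖ := by congr 1; abel
      _ ≤ ‖a s 0‖ + ‖a s (z s) - a s 0‖ := norm_add_le _ _
      _ ≤ _ := by linarith
  have hint : ∀ z : C(X, E), Integrable (fun s => a s (z s)) vol := fun z =>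
    (integrable_const (B + L * ‖z‖)).mono' (hmeas z) (hb z)
  have hcont : ∀ z : C(X, E), Continuous fun t => c + ∫ s in I t, a s (z s) ∂vol := fun z =>
    continuous_const.add (hI.continuous_setIntegral (hint z) (hb z))
  obtain ⟨C, hC0, hC⟩ := hI.gronwall (vol := vol) hL
  refine existsUnique_of_exists_of_unique ?_ ?_
  · obtain ⟨e, he, heI⟩ := hI.exists_weight (2 * L) (by positivity)
    -- Fixed points `w` correspond to solutions `e • w`. Dividing by the weight of rate `2 * L`
    -- makes the integral operator a contraction of ratio `1 / 2` in the sup norm on all of `X` at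
    -- once.
    let Φ : C(X, E) → C(X, E) := fun w =>
      ⟨fun t => (e t)⁻¹ • (c + ∫ s in I t, a s ((e • w) s) ∂vol),
        (e.continuous.inv₀ fun t => (he t).ne').smul (hcont (e • w))⟩
    have hΦ : ContractingWith (1 / 2) Φ := by
      refine ⟨by rw [← NNReal.coe_lt_coe]; norm_num, LipschitzWith.of_dist_le_mul fun w w' => ?_⟩
      rw [dist_eq_norm, dist_eq_norm]
      rw [ContinuousMap.norm_le _ (by positivity)]
      intro t
      simp only [Φ, ContinuousMap.sub_apply, ContinuousMap.coe_mk, ← smul_sub,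
        add_sub_add_left_eq_sub]
      rw [← integral_sub (hint _).integrableOn (hint _).integrableOn, norm_smul, norm_inv,
        Real.norm_of_nonneg (he t).le]
      have h1 : ‖∫ s in I t, (a s ((e • w) s) - a s ((e • w') s)) ∂vol‖
          ≤ ∫ s in I t, (L * ‖w - w'‖) * e s ∂vol := by
        refine norm_integral_le_of_norm_le
          ((e.integrable_of_compactSpace vol).const_mul _).integrableOn ?_
        filter_upwards [ae_restrict_of_ae hlip] with s hs
        refine (hs _ _).trans ?_
        simp only [ContinuousMap.smul_apply', ← smul_sub, norm_smul, Real.norm_of_nonneg (he s).le]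
        have := (w - w').norm_coe_le_norm s
        rw [ContinuousMap.sub_apply] at this
        have := mul_le_mul_of_nonneg_left this (mul_nonneg hL.le (he s).le)
        linarith
      rw [integral_const_mul] at h1
      have h2 := mul_le_mul_of_nonneg_left (heI t) (by positivity : 0 ≤ L * ‖w - w'‖)
      rw [inv_mul_le_iff₀ (he t)]
      refine h1.trans (h2.trans (le_of_eq ?_))
      rw [NNReal.coe_div]
      field_simp
      simp
    obtain ⟨w, hw⟩ : ∃ w, Φ w = w := ⟨_, hΦ.fixedPoint_isFixedPt⟩
    refine ⟨e • w, fun t => ?_⟩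
    have h1 : (e t)⁻¹ • (c + ∫ s in I t, a s ((e • w) s) ∂vol) = w t := congrArg (· t) hw
    rw [ContinuousMap.smul_apply', ← h1, smul_inv_smul₀ (he t).ne']
  · intro z z' hz hz'
    have key : ∀ t, ‖z t - z' t‖ ≤ C * 0 := by
      refine hC ⟨fun t => ‖z t - z' t‖, by fun_prop⟩ 0 le_rfl
        (fun t => norm_nonneg (z t - z' t)) fun t => ?_
      simp only [ContinuousMap.coe_mk, zero_add]
      rw [hz t, hz' t, add_sub_add_left_eq_sub,
        ← integral_sub (hint _).integrableOn (hint _).integrableOn, ← integral_const_mul]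
      refine norm_integral_le_of_norm_le ?_ ?_
      · exact ((ContinuousMap.integrable_of_compactSpace
          ⟨fun t => ‖z t - z' t‖, by fun_prop⟩ vol).const_mul L).integrableOn
      · filter_upwards [ae_restrict_of_ae hlip] with s hs using hs _ _
    ext1 t
    have := key t
    rw [mul_zero] at this
    exact sub_eq_zero.1 (norm_le_zero_iff.1 this)

end Volterra

/-! ### Initial and final segments of `[0, T]` as Volterra families -/

namespace ControlProblem

variable {n m : ℕ} (P : ControlProblem n m)

instance : Nonempty P.Time := ⟨P.finalTime⟩

theorem volume_preimage_time_le (S : Set ℝ) :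
    (volume : Measure P.Time) (Subtype.val ⁻¹' S) ≤ volume S := by
  have h : (volume : Measure P.Time) (Subtype.val ⁻¹' S)
      = volume (Subtype.val '' (Subtype.val ⁻¹' S : Set P.Time)) :=
    (MeasurableEmbedding.subtype_coe measurableSet_Icc).comap_apply _ _
  rw [h]
  exact measure_mono (Set.image_preimage_subset _ _)

theorem setIntegral_time_le {S : Set P.Time} (hS : MeasurableSet S) {R : Set ℝ}
    (hSR : ∀ s ∈ S, (s : ℝ) ∈ R) {g : ℝ → ℝ} (hg : IntegrableOn g R) (hg0 : ∀ s, 0 ≤ g s) :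
    ∫ s in S, g s ≤ ∫ s in R, g s := by
  have hemb : MeasurableEmbedding (Subtype.val : P.Time → ℝ) :=
    MeasurableEmbedding.subtype_coe measurableSet_Icc
  have h1 : ∫ s in S, g s = ∫ s in Set.Icc 0 P.T, (Subtype.val '' S).indicator g s := by
    rw [← integral_indicator hS, ← integral_subtype_comap measurableSet_Icc]
    refine integral_congr_ae (.of_forall fun s => ?_)
    have : (s : ℝ) ∈ Subtype.val '' S ↔ s ∈ S := Subtype.val_injective.mem_set_image
    by_cases hs : s ∈ S <;> simp only [Set.indicator, this, hs, if_true, if_false]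
  rw [h1, setIntegral_indicator (hemb.measurableSet_image.2 hS)]
  refine setIntegral_mono_set hg (.of_forall hg0) (LE.le.eventuallyLE ?_)
  rintro _ ⟨-, s, hs, rfl⟩
  exact hSR s hs

theorem tendsto_symmDiff_time {I : P.Time → Set P.Time}
    (hI : ∀ t t₀, symmDiff (I t) (I t₀) ⊆ Subtype.val ⁻¹' Set.uIcc (t : ℝ) t₀) (t₀ : P.Time) :
    Tendsto (fun t => volume.real (symmDiff (I t) (I t₀))) (𝓝 t₀) (𝓝 0) := by
  have h : ∀ t : P.Time, volume.real (symmDiff (I t) (I t₀)) ≤ |(t₀ : ℝ) - t| := fun t => by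
    refine ENNReal.toReal_le_of_le_ofReal (abs_nonneg _) ?_
    refine (measure_mono (hI t t₀)).trans ((P.volume_preimage_time_le _).trans ?_)
    rw [Set.uIcc, Real.volume_Icc, max_sub_min_eq_abs]
  refine squeeze_zero (fun _ => measureReal_nonneg) h ?_
  have : Continuous fun t : P.Time => |(t₀ : ℝ) - t| := by fun_prop
  simpa using this.tendsto t₀

/-- The weight is `exp (K * t)`: its integral over the whole half-line up to `t` is exactly `exp (K
* t) / K`, and restricting to `[0, t]` only lowers it. For `Set.Ici` the exponent changes sign. -/
theorem isVolterra_Iic : IsVolterra (volume : Measure P.Time) Set.Iic where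
  measurableSet _ := measurableSet_Iic
  tendsto_symmDiff := P.tendsto_symmDiff_time fun t t₀ s hs => by
    simp only [Set.mem_symmDiff, Set.mem_Iic, not_le, Set.mem_preimage, Set.mem_uIcc,
      Subtype.coe_le_coe] at hs ⊢
    grind
  exists_weight K hK := by
    refine ⟨⟨fun t => Real.exp (K * t), by fun_prop⟩, fun t => Real.exp_pos _, fun t => ?_⟩
    have h := integrableOn_exp_mul_Iic hK (t : ℝ)
    refine (P.setIntegral_time_le measurableSet_Iic (R := Set.Iic (t : ℝ)) (fun s hs => hs)
      h fun s => (Real.exp_pos _).le).trans ?_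
    rw [integral_exp_mul_Iic hK]
    rfl

theorem isVolterra_Ici : IsVolterra (volume : Measure P.Time) Set.Ici where
  measurableSet _ := measurableSet_Ici
  tendsto_symmDiff := P.tendsto_symmDiff_time fun t t₀ s hs => by
    simp only [Set.mem_symmDiff, Set.mem_Ici, not_le, Set.mem_preimage, Set.mem_uIcc,
      Subtype.coe_le_coe] at hs ⊢
    grind
  exists_weight K hK := by
    refine ⟨⟨fun t => Real.exp (-K * t), by fun_prop⟩, fun t => Real.exp_pos _, fun t => ?_⟩
    have h := integrableOn_exp_mul_Ioi (neg_lt_zero.2 hK) (t : ℝ)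
    refine (P.setIntegral_time_le measurableSet_Ici (R := Set.Ici (t : ℝ)) (fun s hs => hs)
      ((integrableOn_Ici_iff_integrableOn_Ioi (by finiteness)).2 h)
      fun s => (Real.exp_pos _).le).trans ?_
    rw [integral_Ici_eq_integral_Ioi, integral_exp_mul_Ioi (neg_lt_zero.2 hK), neg_div_neg_eq]
    rfl

end ControlProblem

/-! ### Extension of the data to globally continuous functions -/

/-- Mean value inequality for `g - fderiv ℝ g x` on the ball of radius `‖y - x‖` around `x`, where
the derivative of this difference is at most `L * ‖y - x‖`. -/
theorem norm_sub_sub_fderiv_le {E F : Type*} [NormedAddCommGroup E] [NormedSpace ℝ E]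
    [NormedAddCommGroup F] [NormedSpace ℝ F] {g : E → F} (hg : Differentiable ℝ g) {L : ℝ}
    (hL : 0 ≤ L) (hlip : ∀ x y, ‖fderiv ℝ g x - fderiv ℝ g y‖ ≤ L * ‖x - y‖) (x y : E) :
    ‖g y - g x - fderiv ℝ g x (y - x)‖ ≤ L * ‖y - x‖ ^ 2 := by
  have h := (convex_closedBall x ‖y - x‖).norm_image_sub_le_of_norm_fderiv_le' (𝕜 := ℝ)
    (f := g) (φ := fderiv ℝ g x) (C := L * ‖y - x‖) (x := x) (y := y) (fun z _ => hg z)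
    (fun z hz => (hlip z x).trans (mul_le_mul_of_nonneg_left (mem_closedBall_iff_norm.1 hz) hL))
    (by simp) (by simp [dist_eq_norm])
  rwa [pow_two, ← mul_assoc]

namespace ControlProblem

variable {n m : ℕ} (P : ControlProblem n m)

/-- `F` and `G` are continuous extensions of `f` and `∂f/∂x` beyond the input set `U`, and `L`
controls the data of the problem. -/
structure IsExtension (F : P.Time × RVec n × RVec m → RVec n)
    (G : P.Time × RVec n × RVec m → (RVec n →L[ℝ] RVec n)) (L : ℝ) : Prop where
  pos : 0 < L
  continuous_F : Continuous F
  continuous_G : Continuous G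
  eq_F : ∀ (t : P.Time) x, ∀ u ∈ P.U, P.f t x u = F (t, x, u)
  eq_G : ∀ (t : P.Time) x, ∀ u ∈ P.U, fderiv ℝ (fun z => P.f t z u) x = G (t, x, u)
  lip_F : ∀ t x x', ∀ u ∈ P.U, ‖F (t, x, u) - F (t, x', u)‖ ≤ L * ‖x - x'‖
  lip_G : ∀ t x x', ∀ u ∈ P.U, ‖G (t, x, u) - G (t, x', u)‖ ≤ L * ‖x - x'‖
  norm_G_le : ∀ t x, ∀ u ∈ P.U, ‖G (t, x, u)‖ ≤ L
  taylor_F : ∀ t x y, ∀ u ∈ P.U,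
    ‖F (t, y, u) - F (t, x, u) - G (t, x, u) (y - x)‖ ≤ L * ‖y - x‖ ^ 2
  continuous_cost : Continuous P.Ψ
  lip_gradient : ∀ x x', ‖gradient P.Ψ x - gradient P.Ψ x'‖ ≤ L * ‖x - x'‖
  taylor_cost : ∀ x y, |P.Ψ y - P.Ψ x - inner ℝ (gradient P.Ψ x) (y - x)| ≤ L * ‖y - x‖ ^ 2

/-- The data are controlled only for inputs in `U`, whereas measurability of averages and testing of
weak convergence call for functions continuous on all of `ℝᵐ`. Values off `U` do not matter, since
relaxed inputs do not charge `Uᶜ` at almost every time. -/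
theorem exists_extend {E : Type*} [NormedAddCommGroup E] [NormedSpace ℝ E]
    [FiniteDimensional ℝ E] {L : ℝ} (hL : 0 < L) (g : P.Time × RVec n × RVec m → E)
    (hg : ∀ (t₁ t₂ : P.Time) x₁ x₂, ∀ u₁ ∈ P.U, ∀ u₂ ∈ P.U, ‖g (t₁, x₁, u₁) - g (t₂, x₂, u₂)‖
      ≤ L * (|(t₁ : ℝ) - t₂| + ‖x₁ - x₂‖ + ‖u₁ - u₂‖)) :
    ∃ F : P.Time × RVec n × RVec m → E, Continuous F ∧
      ∀ (t : P.Time) x, ∀ u ∈ P.U, g (t, x, u) = F (t, x, u) := by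
  -- The factor `3` bounds the sum of the three distances by the max distance on the product.
  have h : LipschitzOnWith (L * 3).toNNReal g {q | q.2.2 ∈ P.U} := by
    refine LipschitzOnWith.of_dist_le_mul ?_
    rintro ⟨t₁, x₁, u₁⟩ h₁ ⟨t₂, x₂, u₂⟩ h₂
    rw [Real.coe_toNNReal _ (by positivity), dist_eq_norm, mul_assoc]
    refine (hg t₁ t₂ x₁ x₂ u₁ h₁ u₂ h₂).trans (mul_le_mul_of_nonneg_left ?_ hL.le)
    have e1 : |(t₁ : ℝ) - t₂| = dist t₁ t₂ := rfl
    rw [e1, ← dist_eq_norm, ← dist_eq_norm, Prod.dist_eq, Prod.dist_eq]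
    have a1 := le_max_left (dist t₁ t₂) (max (dist x₁ x₂) (dist u₁ u₂))
    have a2 := le_max_right (dist t₁ t₂) (max (dist x₁ x₂) (dist u₁ u₂))
    have a3 := le_max_left (dist x₁ x₂) (dist u₁ u₂)
    have a4 := le_max_right (dist x₁ x₂) (dist u₁ u₂)
    dsimp only
    linarith
  obtain ⟨F, hF, hFg⟩ := h.extend_finite_dimension
  exact ⟨F, hF.continuous, fun t x u hu => hFg (x := (t, x, u)) hu⟩

variable {P}

/-- `F` and `G` are extended independently, so `G` need not be the state derivative of `F` off `U`.
This is why the estimates relating them are claimed for `u ∈ P.U` only. -/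
theorem LipschitzC1.exists_extension (hP : P.LipschitzC1) :
    ∃ F G L, P.IsExtension F G L := by
  obtain ⟨hΨ, hf, L, hL, hΨL, hΨL', h⟩ := hP
  obtain ⟨F, hF, hFf⟩ := P.exists_extend hL (fun q => P.f q.1 q.2.1 q.2.2)
    fun t₁ t₂ x₁ x₂ u₁ h₁ u₂ h₂ => (h t₁ t₁.2 t₂ t₂.2 x₁ x₂ u₁ h₁ u₂ h₂).1
  obtain ⟨G, hG, hGf⟩ := P.exists_extend hL
    (fun q => fderiv ℝ (fun z => P.f q.1 z q.2.2) q.2.1)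
    fun t₁ t₂ x₁ x₂ u₁ h₁ u₂ h₂ => (h t₁ t₁.2 t₂ t₂.2 x₁ x₂ u₁ h₁ u₂ h₂).2.1
  dsimp only at hFf hGf
  have lipf : ∀ t : P.Time, ∀ x x', ∀ u ∈ P.U, ‖P.f t x u - P.f t x' u‖ ≤ L * ‖x - x'‖ := by
    intro t x x' u hu
    simpa using (h t t.2 t t.2 x x' u hu u hu).1
  have lipf' : ∀ t : P.Time, ∀ x x', ∀ u ∈ P.U, ‖fderiv ℝ (fun z => P.f t z u) x
      - fderiv ℝ (fun z => P.f t z u) x'‖ ≤ L * ‖x - x'‖ := by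
    intro t x x' u hu
    simpa using (h t t.2 t t.2 x x' u hu u hu).2.1
  have hgrad : ∀ x y, inner ℝ (gradient P.Ψ x) y = fderiv ℝ P.Ψ x y := fun x y => by
    rw [gradient, InnerProductSpace.toDual_symm_apply]
  refine ⟨F, G, L, hL, hF, hG, hFf, hGf, ?_, ?_, ?_, ?_, hΨ.continuous, ?_, ?_⟩
  · intro t x x' u hu
    rw [← hFf t x u hu, ← hFf t x' u hu]
    exact lipf t x x' u hu
  · intro t x x' u hu
    rw [← hGf t x u hu, ← hGf t x' u hu]
    exact lipf' t x x' u hu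
  · intro t x u hu
    rw [← hGf t x u hu]
    exact norm_fderiv_le_of_lip' ℝ hL.le (.of_forall fun z => lipf t z x u hu)
  · intro t x y u hu
    rw [← hGf t x u hu, ← hFf t x u hu, ← hFf t y u hu]
    exact norm_sub_sub_fderiv_le (g := fun z => P.f t z u) (fun z => (hf t t.2 z u hu).1) hL.le
      (fun x x' => lipf' t x x' u hu) x y
  · intro x x'
    rw [gradient, gradient, ← map_sub, LinearIsometryEquiv.norm_map]
    exact hΨL' x x'
  · intro x y
    rw [hgrad]
    exact norm_sub_sub_fderiv_le hΨ hL.le hΨL' x y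

/-! ### Averages over relaxed inputs -/

theorem exists_bound_of_continuous (P : ControlProblem n m) {E : Type*} [NormedAddCommGroup E]
    {φ : P.Time × RVec m → E} (hφ : Continuous φ) :
    ∃ B, 0 ≤ B ∧ ∀ t, ∀ u ∈ P.U, ‖φ (t, u)‖ ≤ B := by
  obtain ⟨B, hB⟩ := (isCompact_univ.prod P.isCompact_U).exists_bound_of_continuousOn
    (hφ.continuousOn (s := (Set.univ : Set P.Time) ×ˢ P.U))
  exact ⟨max B 0, le_max_right _ _, fun t u hu =>
    (hB (t, u) ⟨Set.mem_univ _, hu⟩).trans (le_max_left _ _)⟩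

namespace RelaxedInput

variable {E : Type*} [NormedAddCommGroup E] [NormedSpace ℝ E]

theorem ae_mem (μ : P.RelaxedInput) : ∀ᵐ t, ∀ᵐ u ∂μ.kernel t, u ∈ P.U := by
  filter_upwards [μ.support_subset] with t ht
  exact mem_of_superset Measure.support_mem_ae ht

/-- The average `∫ φ (t, u) dμ_t (u)`. -/
def avg (μ : P.RelaxedInput) (φ : P.Time × RVec m → E) (t : P.Time) : E :=
  ∫ u, φ (t, u) ∂μ.kernel t

theorem stronglyMeasurable_avg [SecondCountableTopology E] [MeasurableSpace E] [BorelSpace E]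
    (μ : P.RelaxedInput) {φ : P.Time × RVec m → E}
    (hφ : Continuous φ) : StronglyMeasurable (μ.avg φ) :=
  StronglyMeasurable.integral_kernel_prod_right' hφ.stronglyMeasurable

/-- The exceptional null set does not depend on `φ`. The neighbouring almost-everywhere lemmas have
the same order of quantifiers, which lets integrands range over uncountable families, such as all
states `z`, `z'` in a Lipschitz condition. -/
theorem ae_integrable {E : Type*} [NormedAddCommGroup E] [SecondCountableTopology E]
    [MeasurableSpace E] [BorelSpace E] (μ : P.RelaxedInput) :
    ∀ᵐ t, ∀ φ : P.Time × RVec m → E, Continuous φ →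
      Integrable (fun u => φ (t, u)) (μ.kernel t) := by
  filter_upwards [μ.ae_mem] with t ht φ hφ
  obtain ⟨B, -, hB⟩ := P.exists_bound_of_continuous hφ
  refine (integrable_const B).mono' (hφ.comp (by fun_prop)).aestronglyMeasurable ?_
  filter_upwards [ht] with u hu using hB t u hu

theorem ae_norm_avg_le (μ : P.RelaxedInput) : ∀ᵐ t, ∀ (φ : P.Time × RVec m → E) (B : ℝ),
    (∀ u ∈ P.U, ‖φ (t, u)‖ ≤ B) → ‖μ.avg φ t‖ ≤ B := by
  filter_upwards [μ.ae_mem] with t ht φ B hB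
  have h := norm_integral_le_of_norm_le_const (μ := μ.kernel t) (f := fun u => φ (t, u)) (C := B)
    (by filter_upwards [ht] with u hu using hB u hu)
  unfold avg
  simpa using h

theorem integrable_avg [SecondCountableTopology E] [MeasurableSpace E] [BorelSpace E]
    (μ : P.RelaxedInput) {φ : P.Time × RVec m → E}
    (hφ : Continuous φ) : Integrable (μ.avg φ) := by
  obtain ⟨B, -, hB⟩ := P.exists_bound_of_continuous hφ
  refine (integrable_const B).mono' (μ.stronglyMeasurable_avg hφ).aestronglyMeasurable ?_
  filter_upwards [μ.ae_norm_avg_le (E := E)] with t ht using ht _ _ (hB t)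

theorem ae_avg_sub [SecondCountableTopology E] [MeasurableSpace E] [BorelSpace E]
    (μ : P.RelaxedInput) : ∀ᵐ t, ∀ φ ψ : P.Time × RVec m → E, Continuous φ → Continuous ψ →
      μ.avg (fun q => φ q - ψ q) t = μ.avg φ t - μ.avg ψ t := by
  filter_upwards [μ.ae_integrable (E := E)] with t ht φ ψ hφ hψ
  exact integral_sub (ht φ hφ) (ht ψ hψ)

theorem ae_norm_avg_sub_avg_le [SecondCountableTopology E] [MeasurableSpace E] [BorelSpace E]
    (μ : P.RelaxedInput) : ∀ᵐ t, ∀ φ ψ : P.Time × RVec m → E, Continuous φ → Continuous ψ →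
      ∀ B, (∀ u ∈ P.U, ‖φ (t, u) - ψ (t, u)‖ ≤ B) → ‖μ.avg φ t - μ.avg ψ t‖ ≤ B := by
  filter_upwards [μ.ae_norm_avg_le (E := E), μ.ae_avg_sub (E := E)] with t h1 h2 φ ψ hφ hψ B hB
  rw [← h2 φ ψ hφ hψ]
  exact h1 _ B hB

end RelaxedInput

/-! ### The state and costate equations -/

/-- `z` solves `z t = c + ∫ s in I t, ∫ Q (s, z s, u) dμ_s (u) ds`. -/
def IsSolution (I : P.Time → Set P.Time) (c : RVec n) (Q : P.Time × RVec n × RVec m → RVec n)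
    (μ : P.RelaxedInput) (z : C(P.Time, RVec n)) : Prop :=
  ∀ t, z t = c + ∫ s in I t, μ.avg (fun q => Q (q.1, z q.1, q.2)) s

/-- A continuous vector field, Lipschitz in the state for inputs in `U`. -/
structure IsLipField (Q : P.Time × RVec n × RVec m → RVec n) (L : ℝ) : Prop where
  continuous : Continuous Q
  lip : ∀ t x x', ∀ u ∈ P.U, ‖Q (t, x, u) - Q (t, x', u)‖ ≤ L * ‖x - x'‖

theorem IsLipField.continuous_comp {Q : P.Time × RVec n × RVec m → RVec n} {L : ℝ}
    (hQ : IsLipField Q L) (z : C(P.Time, RVec n)) :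
    Continuous fun q : P.Time × RVec m => Q (q.1, z q.1, q.2) :=
  hQ.continuous.comp (by fun_prop)

theorem IsLipField.existsUnique {Q : P.Time × RVec n × RVec m → RVec n} {L : ℝ} (hL : 0 < L)
    (hQ : IsLipField Q L) {I : P.Time → Set P.Time} (hI : IsVolterra volume I) (c : RVec n)
    (μ : P.RelaxedInput) : ∃! z, IsSolution I c Q μ z := by
  obtain ⟨B, -, hB⟩ := P.exists_bound_of_continuous (hQ.continuous_comp 0)
  refine hI.existsUnique (L := L) (B := B) hL c (a := fun s z => ∫ u, Q (s, z, u) ∂μ.kernel s)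
    (fun z => (μ.stronglyMeasurable_avg (hQ.continuous_comp z)).aestronglyMeasurable) ?_ ?_
  · filter_upwards [μ.ae_norm_avg_sub_avg_le (E := RVec n)] with s hs z z'
    have h : ∀ z : RVec n, Continuous fun q : P.Time × RVec m => Q (q.1, z, q.2) := fun z =>
      hQ.continuous.comp (by fun_prop)
    exact hs (fun q => Q (q.1, z, q.2)) (fun q => Q (q.1, z', q.2)) (h z) (h z') (L * ‖z - z'‖)
      (hQ.lip s z z')
  · filter_upwards [μ.ae_norm_avg_le (E := RVec n)] with s h1
    exact h1 (fun q => Q (q.1, (0 : C(P.Time, RVec n)) q.1, q.2)) B (hB s)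

theorem RelaxedInput.ae_avg_congr {E : Type*} [NormedAddCommGroup E] [NormedSpace ℝ E]
    (μ : P.RelaxedInput) : ∀ᵐ t, ∀ φ ψ : RVec m → E, (∀ u ∈ P.U, φ u = ψ u) →
      ∫ u, φ u ∂μ.kernel t = ∫ u, ψ u ∂μ.kernel t := by
  filter_upwards [μ.ae_mem] with t ht φ ψ h
  refine integral_congr_ae ?_
  filter_upwards [ht] with u hu using h u hu

namespace IsExtension

variable {F : P.Time × RVec n × RVec m → RVec n}
  {G : P.Time × RVec n × RVec m → (RVec n →L[ℝ] RVec n)} {L : ℝ}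

theorem isLipField_F (h : P.IsExtension F G L) : IsLipField F L := ⟨h.continuous_F, h.lip_F⟩

theorem isTrajectory_iff (h : P.IsExtension F G L) {x : C(P.Time, RVec n)} {μ : P.RelaxedInput} :
    P.IsTrajectory x μ ↔ IsSolution Set.Iic P.ξ F μ x := by
  refine forall_congr' fun t => ?_
  rw [integral_congr_ae (g := fun s => μ.avg (fun q => F (q.1, x q.1, q.2)) s)]
  filter_upwards [ae_restrict_of_ae (μ.ae_avg_congr (E := RVec n))] with s hs
  exact hs _ _ fun u hu => h.eq_F s (x s) u hu

/-- The right-hand side of the costate equation. -/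
def adjointField (G : P.Time × RVec n × RVec m → (RVec n →L[ℝ] RVec n)) (x : C(P.Time, RVec n))
    (q : P.Time × RVec n × RVec m) : RVec n :=
  ContinuousLinearMap.adjoint (G (q.1, x q.1, q.2.2)) q.2.1

theorem continuous_adjoint (h : P.IsExtension F G L) (x : C(P.Time, RVec n)) :
    Continuous fun q : P.Time × RVec m =>
      ContinuousLinearMap.adjoint (G (q.1, x q.1, q.2)) :=
  (LinearIsometryEquiv.continuous _).comp (h.continuous_G.comp (by fun_prop))

theorem isLipField_adjointField (h : P.IsExtension F G L) (x : C(P.Time, RVec n)) :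
    IsLipField (adjointField G x) L where
  continuous := by
    have h1 : Continuous fun q : P.Time × RVec n × RVec m => G (q.1, x q.1, q.2.2) :=
      h.continuous_G.comp (by fun_prop)
    exact ((LinearIsometryEquiv.continuous
      (ContinuousLinearMap.adjoint (𝕜 := ℝ) (E := RVec n) (F := RVec n))).comp h1).clm_apply
        (by fun_prop)
  lip t p p' u hu := by
    simp only [adjointField, ← map_sub]
    refine (ContinuousLinearMap.le_opNorm _ _).trans ?_
    rw [LinearIsometryEquiv.norm_map]
    exact mul_le_mul_of_nonneg_right (h.norm_G_le t _ u hu) (norm_nonneg _)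

theorem isCostate_iff (h : P.IsExtension F G L) {y : P.Pair} {p : C(P.Time, RVec n)} :
    P.IsCostate y p ↔
      IsSolution Set.Ici (gradient P.Ψ (y.1 P.finalTime)) (adjointField G y.1) y.2 p := by
  refine forall_congr' fun t => ?_
  rw [integral_congr_ae (g := fun s => y.2.avg (fun q => adjointField G y.1 (q.1, p q.1, q.2)) s)]
  filter_upwards [ae_restrict_of_ae (y.2.ae_avg_congr (E := RVec n →L[ℝ] RVec n)),
    ae_restrict_of_ae (y.2.ae_integrable (E := RVec n →L[ℝ] RVec n))] with s hs hs'
  rw [hs _ (fun u => ContinuousLinearMap.adjoint (G (s, y.1 s, u))) fun u hu => by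
    rw [h.eq_G s (y.1 s) u hu]]
  -- Evaluating the operator-valued average at `p s` turns the costate equation into an equation for
  -- the averaged field `adjointField`.
  exact ContinuousLinearMap.integral_apply (hs' _ (h.continuous_adjoint y.1)) _

theorem existsUnique_trajectory (h : P.IsExtension F G L) (μ : P.RelaxedInput) :
    ∃! x, P.IsTrajectory x μ := by
  simp_rw [h.isTrajectory_iff]
  exact h.isLipField_F.existsUnique h.pos P.isVolterra_Iic _ _

theorem existsUnique_costate (h : P.IsExtension F G L) (y : P.Pair) :
    ∃! p, P.IsCostate y p := by
  simp_rw [h.isCostate_iff]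
  exact (h.isLipField_adjointField y.1).existsUnique h.pos P.isVolterra_Ici _ _

theorem isSolution_costate (h : P.IsExtension F G L) (y : P.Pair) :
    IsSolution Set.Ici (gradient P.Ψ (y.1 P.finalTime)) (adjointField G y.1) y.2 (P.costate y) :=
  h.isCostate_iff.1 (Classical.epsilon_spec (h.existsUnique_costate y).exists)

end IsExtension

/-! ### Weak convergence of relaxed inputs -/

namespace RelaxedInput

theorem tendsto_iff {ι : Type*} {l : Filter ι} {a : ι → P.RelaxedInput} {μ : P.RelaxedInput} :
    Tendsto a l (𝓝 μ) ↔ ∀ ψ : BoundedContinuousFunction (P.Time × RVec m) ℝ,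
      Tendsto (fun j => ∫ t, (a j).avg ψ t) l (𝓝 (∫ t, μ.avg ψ t)) := by
  rw [nhds_induced, tendsto_comap_iff, FiniteMeasure.tendsto_iff_forall_integral_tendsto]
  refine forall_congr' fun ψ => ?_
  have h : ∀ κ : P.RelaxedInput, ∫ q, ψ q ∂(κ.toFiniteMeasure : Measure (P.Time × RVec m))
      = ∫ t, κ.avg ψ t := fun κ =>
    Measure.integral_compProd (ψ.integrable (κ.toFiniteMeasure : Measure (P.Time × RVec m)))
  simp only [Function.comp_def, h]

variable {ι : Type*} {l : Filter ι} {a : ι → P.RelaxedInput} {μ : P.RelaxedInput}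

/-- `φ` may be unbounded off `U`. Clamping it to `[-B, B]`, with `B` a bound on `U`, gives an
admissible test function with the same averages. -/
theorem tendsto_integral_mul_avg (ha : Tendsto a l (𝓝 μ)) (c : BoundedContinuousFunction P.Time ℝ)
    {φ : P.Time × RVec m → ℝ} (hφ : Continuous φ) :
    Tendsto (fun j => ∫ t, c t * (a j).avg φ t) l (𝓝 (∫ t, c t * μ.avg φ t)) := by
  obtain ⟨B, hB0, hB⟩ := P.exists_bound_of_continuous hφ
  let ψ : BoundedContinuousFunction (P.Time × RVec m) ℝ :=
    BoundedContinuousFunction.ofNormedAddCommGroup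
      (fun q => c q.1 * max (-B) (min B (φ q))) (by fun_prop) (‖c‖ * B) fun q => by
        rw [norm_mul]
        refine mul_le_mul (c.norm_coe_le_norm _) ?_ (norm_nonneg _) (norm_nonneg _)
        rw [Real.norm_eq_abs, abs_le]
        exact ⟨le_max_left _ _, max_le (by linarith) (min_le_left _ _)⟩
  have h : ∀ κ : P.RelaxedInput, ∫ t, κ.avg ψ t = ∫ t, c t * κ.avg φ t := fun κ => by
    refine integral_congr_ae ?_
    filter_upwards [κ.ae_avg_congr (E := ℝ)] with t ht
    rw [avg, avg, ← integral_const_mul]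
    refine ht _ _ fun u hu => ?_
    have := abs_le.1 (hB t u hu)
    simp only [ψ, BoundedContinuousFunction.coe_ofNormedAddCommGroup]
    rw [min_eq_right this.2, max_eq_right this.1]
  simpa only [h] using tendsto_iff.1 ha ψ

/-- All relaxed inputs share Lebesgue measure as time marginal. Replacing the indicator of `S` by an
`L¹`-close continuous function therefore costs an error that is uniform over the inputs. -/
theorem tendsto_setIntegral_avg_real (ha : Tendsto a l (𝓝 μ)) {S : Set P.Time}
    (hS : MeasurableSet S) {φ : P.Time × RVec m → ℝ} (hφ : Continuous φ) :
    Tendsto (fun j => ∫ t in S, (a j).avg φ t) l (𝓝 (∫ t in S, μ.avg φ t)) := by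
  obtain ⟨B, hB0, hB⟩ := P.exists_bound_of_continuous hφ
  rw [Metric.tendsto_nhds]
  intro ε hε
  have hη : 0 < ε / (4 * (B + 1)) := by positivity
  obtain ⟨c, hc, hci⟩ := ((integrable_const (1 : ℝ)).indicator hS :
    Integrable (S.indicator fun _ => (1 : ℝ))
      (volume : Measure P.Time)).exists_boundedContinuous_integral_sub_le hη
  have h : ∀ κ : P.RelaxedInput,
      |(∫ t in S, κ.avg φ t) - ∫ t, c t * κ.avg φ t| ≤ ε / 4 := fun κ => by
    have hκ := κ.integrable_avg hφ
    have hcκ : Integrable fun t => c t * κ.avg φ t :=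
      hκ.bdd_mul c.continuous.aestronglyMeasurable (.of_forall c.norm_coe_le_norm)
    have hd : Integrable fun t => ‖S.indicator (fun _ => (1 : ℝ)) t - c t‖ :=
      (((integrable_const (1 : ℝ)).indicator hS).sub hci).norm
    rw [← integral_indicator hS, ← integral_sub (hκ.indicator hS) hcκ, ← Real.norm_eq_abs]
    calc _ ≤ ∫ t, ‖S.indicator (fun _ => (1 : ℝ)) t - c t‖ * B := by
          refine norm_integral_le_of_norm_le (hd.mul_const B) ?_
          filter_upwards [κ.ae_norm_avg_le (E := ℝ)] with t ht
          have h1 : S.indicator (κ.avg φ) t - c t * κ.avg φ t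
              = (S.indicator (fun _ => (1 : ℝ)) t - c t) * κ.avg φ t := by
            by_cases hts : t ∈ S <;> simp [hts, sub_mul]
          rw [h1, norm_mul]
          exact mul_le_mul_of_nonneg_left (ht φ B (hB t)) (norm_nonneg _)
      _ = (∫ t, ‖S.indicator (fun _ => (1 : ℝ)) t - c t‖) * B := integral_mul_const _ _
      _ ≤ ε / (4 * (B + 1)) * (B + 1) := by
          refine mul_le_mul hc (by linarith) hB0 hη.le
      _ = ε / 4 := by field_simp
  filter_upwards [Metric.tendsto_nhds.1 (tendsto_integral_mul_avg ha c hφ) (ε / 4) (by positivity)]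
    with j hj
  rw [Real.dist_eq, abs_lt] at hj ⊢
  have h1 := abs_le.1 (h (a j))
  have h2 := abs_le.1 (h μ)
  constructor <;> linarith [h1.1, h1.2, h2.1, h2.2, hj.1, hj.2]

theorem tendsto_setIntegral_avg (ha : Tendsto a l (𝓝 μ)) {S : Set P.Time} (hS : MeasurableSet S)
    {φ : P.Time × RVec m → RVec n} (hφ : Continuous φ) :
    Tendsto (fun j => ∫ t in S, (a j).avg φ t) l (𝓝 (∫ t in S, μ.avg φ t)) := by
  rw [(EuclideanSpace.equiv (Fin n) ℝ).toHomeomorph.isInducing.tendsto_nhds_iff, tendsto_pi_nhds]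
  intro i
  have h : ∀ κ : P.RelaxedInput, (EuclideanSpace.proj i : RVec n →L[ℝ] ℝ) (∫ t in S, κ.avg φ t)
      = ∫ t in S, κ.avg (fun q => (EuclideanSpace.proj i : RVec n →L[ℝ] ℝ) (φ q)) t := fun κ => by
    rw [← ContinuousLinearMap.integral_comp_comm _ (κ.integrable_avg hφ).integrableOn]
    refine integral_congr_ae ?_
    filter_upwards [ae_restrict_of_ae (κ.ae_integrable (E := RVec n))] with t ht
    exact (ContinuousLinearMap.integral_comp_comm _ (ht φ hφ)).symm
  have h2 := tendsto_setIntegral_avg_real ha hS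
    (φ := fun q => (EuclideanSpace.proj i : RVec n →L[ℝ] ℝ) (φ q)) (by fun_prop)
  simp_rw [← h] at h2
  exact h2

/-- Weak convergence makes the primitives of averages converge uniformly. -/
theorem eventually_norm_setIntegral_avg_sub_le (ha : Tendsto a l (𝓝 μ)) {I : P.Time → Set P.Time}
    (hI : IsVolterra volume I) {φ : P.Time × RVec m → RVec n} (hφ : Continuous φ) {ε : ℝ}
    (hε : 0 < ε) : ∀ᶠ j in l, ∀ t,
      ‖(∫ s in I t, (a j).avg φ s) - ∫ s in I t, μ.avg φ s‖ ≤ ε := by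
  obtain ⟨B, hB0, hB⟩ := P.exists_bound_of_continuous hφ
  -- The averages are bounded by `B` for every `j`, so the primitives share a modulus of continuity.
  -- On the compact time interval pointwise convergence then upgrades to uniform convergence.
  have heq : Equicontinuous fun j t => ∫ s in I t, (a j).avg φ s := by
    intro t₀
    refine Metric.equicontinuousAt_of_continuity_modulus
      (fun t => B * volume.real (symmDiff (I t₀) (I t))) ?_ _ (.of_forall fun t j => ?_)
    · simpa [symmDiff_comm] using (hI.tendsto_symmDiff t₀).const_mul B
    · rw [dist_eq_norm]
      refine norm_setIntegral_sub_setIntegral_le (hI.measurableSet _) (hI.measurableSet _)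
        ((a j).integrable_avg hφ) ?_
      filter_upwards [(a j).ae_norm_avg_le (E := RVec n)] with t ht using ht _ _ (hB t)
  have h1 := (heq.tendsto_uniformFun_iff_pi l fun t => ∫ s in I t, μ.avg φ s).2
    (tendsto_pi_nhds.2 fun t => tendsto_setIntegral_avg ha (hI.measurableSet t) hφ)
  rw [UniformFun.tendsto_iff_tendstoUniformly, Metric.tendstoUniformly_iff] at h1
  filter_upwards [h1 ε hε] with j hj t
  have := (hj t).le
  rw [dist_comm, dist_eq_norm] at this
  exact this

end RelaxedInput

/-! ### Continuous dependence of solutions on the data -/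

/-- The difference `z j - z₀` splits into the error of the constants, the change of field under the
same input `a j`, and the change of input under the fixed integrand along `z₀`. Only the last uses
weak convergence. Since each `Q j` is Lipschitz, comparing the fields along `z₀` is enough for
Grönwall. -/
theorem IsSolution.tendsto {ι : Type*} {l : Filter ι} {I : P.Time → Set P.Time}
    (hI : IsVolterra volume I) {L : ℝ} (hL : 0 < L)
    {c : ι → RVec n} {c₀ : RVec n} (hc : Tendsto c l (𝓝 c₀))
    {Q : ι → P.Time × RVec n × RVec m → RVec n} {Q₀ : P.Time × RVec n × RVec m → RVec n}
    (hQ : ∀ j, IsLipField (Q j) L) (hQ₀ : IsLipField Q₀ L)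
    {a : ι → P.RelaxedInput} {μ : P.RelaxedInput} (ha : Tendsto a l (𝓝 μ))
    {z : ι → C(P.Time, RVec n)} {z₀ : C(P.Time, RVec n)}
    (hz : ∀ j, IsSolution I (c j) (Q j) (a j) (z j)) (hz₀ : IsSolution I c₀ Q₀ μ z₀)
    (hη : ∀ ε : ℝ, 0 < ε → ∀ᶠ j in l, ∀ t, ∀ u ∈ P.U, ‖Q j (t, z₀ t, u) - Q₀ (t, z₀ t, u)‖ ≤ ε) :
    Tendsto z l (𝓝 z₀) := by
  obtain ⟨C, hC0, hC⟩ := hI.gronwall (vol := (volume : Measure P.Time)) hL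
  set V := volume.real (Set.univ : Set P.Time) with hV
  have hV0 : 0 ≤ V := measureReal_nonneg
  rw [tendsto_iff_norm_sub_tendsto_zero, Metric.tendsto_nhds]
  intro ε hε
  -- The three errors contribute `δ`, `V * δ` and `δ`, hence the factor `2 + V`. Using `C + 1` in
  -- place of `C` keeps the divisor positive.
  have hδ : 0 < ε / (2 * ((C + 1) * (2 + V))) := by positivity
  set δ := ε / (2 * ((C + 1) * (2 + V))) with hδe
  have hc' : ∀ᶠ j in l, ‖c j - c₀‖ ≤ δ := by
    filter_upwards [Metric.tendsto_nhds.1 hc δ hδ] with j hj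
    rw [← dist_eq_norm]
    exact hj.le
  filter_upwards [hc', hη δ hδ,
    RelaxedInput.eventually_norm_setIntegral_avg_sub_le ha hI (hQ₀.continuous_comp z₀) hδ]
    with j h1 h2 h3
  have key : ∀ t, ‖z j t - z₀ t‖ ≤ C * ((2 + V) * δ) := by
    refine hC ⟨fun t => ‖z j t - z₀ t‖, by fun_prop⟩ _ (by positivity)
      (fun t => norm_nonneg (z j t - z₀ t)) fun t => ?_
    simp only [ContinuousMap.coe_mk]
    have i1 := (a j).integrable_avg ((hQ j).continuous_comp (z j))
    have i2 := (a j).integrable_avg (hQ₀.continuous_comp z₀)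
    have e : z j t - z₀ t = (c j - c₀)
        + (∫ s in I t, ((a j).avg (fun q => Q j (q.1, z j q.1, q.2)) s
            - (a j).avg (fun q => Q₀ (q.1, z₀ q.1, q.2)) s))
        + ((∫ s in I t, (a j).avg (fun q => Q₀ (q.1, z₀ q.1, q.2)) s)
            - ∫ s in I t, μ.avg (fun q => Q₀ (q.1, z₀ q.1, q.2)) s) := by
      rw [hz j t, hz₀ t, integral_sub i1.integrableOn i2.integrableOn]
      abel
    have i3 : Integrable (fun s => L * ‖z j s - z₀ s‖) (volume : Measure P.Time) :=
      (ContinuousMap.integrable_of_compactSpace ⟨fun t => ‖z j t - z₀ t‖, by fun_prop⟩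
        volume).const_mul L
    have h4 : ‖∫ s in I t, ((a j).avg (fun q => Q j (q.1, z j q.1, q.2)) s
            - (a j).avg (fun q => Q₀ (q.1, z₀ q.1, q.2)) s)‖
        ≤ ∫ s in I t, (L * ‖z j s - z₀ s‖ + δ) := by
      refine norm_integral_le_of_norm_le (i3.add (integrable_const δ)).integrableOn ?_
      filter_upwards [ae_restrict_of_ae ((a j).ae_norm_avg_sub_avg_le (E := RVec n))] with s hs
      refine hs _ _ ((hQ j).continuous_comp (z j)) (hQ₀.continuous_comp z₀) _ fun u hu => ?_
      calc ‖Q j (s, z j s, u) - Q₀ (s, z₀ s, u)‖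
          = ‖(Q j (s, z j s, u) - Q j (s, z₀ s, u)) + (Q j (s, z₀ s, u) - Q₀ (s, z₀ s, u))‖ := by
            congr 1; abel
        _ ≤ _ := (norm_add_le _ _).trans (add_le_add ((hQ j).lip _ _ _ u hu) (h2 s u hu))
    rw [integral_add i3.integrableOn (integrable_const δ), integral_const_mul,
      setIntegral_const, smul_eq_mul] at h4
    have h5 : volume.real (I t) * δ ≤ V * δ :=
      mul_le_mul_of_nonneg_right (measureReal_mono (Set.subset_univ _)) hδ.le
    rw [e]
    refine (norm_add₃_le ..).trans ?_
    have := h3 t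
    linarith
  rw [dist_zero_right, norm_norm]
  refine lt_of_le_of_lt ((ContinuousMap.norm_le _ (by positivity)).2 key) ?_
  calc C * ((2 + V) * δ) ≤ (C + 1) * (2 + V) * δ := by
        nlinarith [mul_nonneg (by positivity : 0 ≤ 2 + V) hδ.le]
    _ = ε / 2 := by rw [hδe]; field_simp
    _ < ε := by linarith

namespace IsExtension

variable {F : P.Time × RVec n × RVec m → RVec n}
  {G : P.Time × RVec n × RVec m → (RVec n →L[ℝ] RVec n)} {L : ℝ}

theorem tendsto_trajectory (h : P.IsExtension F G L) {ι : Type*} {l : Filter ι}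
    {a : ι → P.RelaxedInput} {μ : P.RelaxedInput} (ha : Tendsto a l (𝓝 μ))
    {x : ι → C(P.Time, RVec n)} {x₀ : C(P.Time, RVec n)}
    (hx : ∀ j, P.IsTrajectory (x j) (a j)) (hx₀ : P.IsTrajectory x₀ μ) :
    Tendsto x l (𝓝 x₀) := by
  simp_rw [h.isTrajectory_iff] at hx hx₀
  exact IsSolution.tendsto P.isVolterra_Iic h.pos tendsto_const_nhds (fun _ => h.isLipField_F)
    h.isLipField_F ha hx hx₀ fun ε hε => .of_forall fun j t u hu => by simpa using hε.le

/-- The adjoint field itself varies with the state curve. Along the limit costate it changes by at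
most `L * ‖x_j - x‖ * ‖p‖`. -/
theorem tendsto_costate (h : P.IsExtension F G L) {ι : Type*} {l : Filter ι}
    {y : ι → P.Pair} {y₀ : P.Pair} (hy : Tendsto y l (𝓝 y₀)) :
    Tendsto (fun j => P.costate (y j)) l (𝓝 (P.costate y₀)) := by
  obtain ⟨hx, ha⟩ := Prod.tendsto_iff y y₀ |>.1 hy
  have hx' := tendsto_iff_norm_sub_tendsto_zero.1 hx
  refine IsSolution.tendsto P.isVolterra_Ici h.pos ?_ (fun j => h.isLipField_adjointField (y j).1)
    (h.isLipField_adjointField y₀.1) ha (fun j => h.isSolution_costate (y j))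
    (h.isSolution_costate y₀) ?_
  · rw [tendsto_iff_norm_sub_tendsto_zero]
    refine squeeze_zero (fun _ => norm_nonneg _) (fun j => (h.lip_gradient _ _).trans
      (mul_le_mul_of_nonneg_left (((y j).1 - y₀.1).norm_coe_le_norm P.finalTime) h.pos.le)) ?_
    simpa using hx'.const_mul L
  · intro ε hε
    have h1 : Tendsto (fun j => L * ‖(y j).1 - y₀.1‖ * ‖P.costate y₀‖) l (𝓝 0) := by
      simpa using (hx'.const_mul L).mul_const _
    filter_upwards [h1.eventually (ge_mem_nhds hε)] with j hj t u hu
    refine le_trans ?_ hj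
    rw [adjointField, adjointField, ← _root_.sub_apply, ← map_sub]
    refine (ContinuousLinearMap.le_opNorm _ _).trans ?_
    rw [LinearIsometryEquiv.norm_map]
    refine mul_le_mul ((h.lip_G _ _ _ u hu).trans (mul_le_mul_of_nonneg_left
      (((y j).1 - y₀.1).norm_coe_le_norm t) h.pos.le)) ((P.costate y₀).norm_coe_le_norm t)
      (norm_nonneg _) (mul_nonneg h.pos.le (norm_nonneg _))

/-- Trajectories form a closed set of pairs. -/
theorem isTrajectory_of_tendsto (h : P.IsExtension F G L) {y : ℕ → P.Pair} {y₀ : P.Pair}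
    (hy : Tendsto y atTop (𝓝 y₀)) (hyt : ∀ j, P.IsTrajectory (y j).1 (y j).2) :
    P.IsTrajectory y₀.1 y₀.2 := by
  obtain ⟨hx, ha⟩ := Prod.tendsto_iff y y₀ |>.1 hy
  -- The curves also converge to the trajectory of the limit input, so uniqueness of limits
  -- identifies the two.
  obtain ⟨x, hxt, -⟩ := h.existsUnique_trajectory y₀.2
  rwa [tendsto_nhds_unique hx (h.tendsto_trajectory ha hyt hxt)]

end IsExtension

/-! ### First-order expansion of the cost -/

namespace RelaxedInput

/-- The relaxed input given by a kernel that is almost everywhere concentrated on `U`. -/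
def ofKernel (κ : Kernel P.Time (RVec m)) (hκ : IsMarkovKernel κ) (h : ∀ᵐ t, κ t P.Uᶜ = 0) :
    P.RelaxedInput where
  kernel := κ
  isMarkov := hκ
  support_subset := by
    filter_upwards [h] with t ht
    exact Measure.support_subset_of_isClosed P.isCompact_U.isClosed (mem_ae_iff.2 ht)

theorem ae_compl_eq_zero (μ : P.RelaxedInput) : ∀ᵐ t, μ.kernel t P.Uᶜ = 0 := μ.ae_mem

/-- The convex combination `(1 - ε) μ + ε μ'`. -/
def mix (μ μ' : P.RelaxedInput) (ε : ℝ) (h0 : 0 ≤ ε) (h1 : ε ≤ 1) : P.RelaxedInput :=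
  ofKernel ⟨fun t => ENNReal.ofReal (1 - ε) • μ.kernel t + ENNReal.ofReal ε • μ'.kernel t, by
      refine Measure.measurable_of_measurable_coe _ fun s hs => ?_
      simp only [Measure.coe_add, Measure.coe_smul, Pi.add_apply, Pi.smul_apply, smul_eq_mul]
      exact ((μ.kernel.measurable_coe hs).const_mul _).add
        ((μ'.kernel.measurable_coe hs).const_mul _)⟩
    ⟨fun t => ⟨by
      simp only [Kernel.coe_mk, Measure.coe_add, Measure.coe_smul, Pi.add_apply, Pi.smul_apply,
        measure_univ, smul_eq_mul, mul_one]
      rw [← ENNReal.ofReal_add (by linarith) h0]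
      simp⟩⟩ (by
    filter_upwards [μ.ae_compl_eq_zero, μ'.ae_compl_eq_zero] with t ht ht'
    simp [ht, ht'])

variable {μ μ' : P.RelaxedInput} {ε : ℝ} {h0 : 0 ≤ ε} {h1 : ε ≤ 1}

theorem mix_kernel (t : P.Time) : (μ.mix μ' ε h0 h1).kernel t
    = ENNReal.ofReal (1 - ε) • μ.kernel t + ENNReal.ofReal ε • μ'.kernel t := rfl

theorem ae_avg_mix {E : Type*} [NormedAddCommGroup E] [NormedSpace ℝ E]
    [SecondCountableTopology E] [MeasurableSpace E] [BorelSpace E] :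
    ∀ᵐ t, ∀ φ : P.Time × RVec m → E, Continuous φ →
      (μ.mix μ' ε h0 h1).avg φ t = (1 - ε) • μ.avg φ t + ε • μ'.avg φ t := by
  filter_upwards [μ.ae_integrable (E := E), μ'.ae_integrable (E := E)] with t ht ht' φ hφ
  rw [avg, mix_kernel, integral_add_measure ((ht φ hφ).smul_measure ENNReal.ofReal_ne_top)
    ((ht' φ hφ).smul_measure ENNReal.ofReal_ne_top), integral_smul_measure, integral_smul_measure,
    ENNReal.toReal_ofReal (by linarith), ENNReal.toReal_ofReal h0]
  rfl

/-- Convexity keeps segments between empirical inputs feasible for the sampled problem, as its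
first-order condition requires. -/
theorem isEmpirical_mix {N : ℕ} {v : Fin N → RVec m} (hμ : P.IsEmpirical v μ)
    (hμ' : P.IsEmpirical v μ') : P.IsEmpirical v (μ.mix μ' ε h0 h1) := by
  obtain ⟨w, hw, hw0, hw1, h⟩ := hμ
  obtain ⟨w', hw', hw0', hw1', h'⟩ := hμ'
  have h2 : 0 ≤ 1 - ε := by linarith
  refine ⟨fun i t => (1 - ε) * w i t + ε * w' i t,
    fun i => ((hw i).const_mul _).add ((hw' i).const_mul _),
    fun i t => add_nonneg (mul_nonneg h2 (hw0 i t)) (mul_nonneg h0 (hw0' i t)), fun t => ?_, ?_⟩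
  · rw [Finset.sum_add_distrib, ← Finset.mul_sum, ← Finset.mul_sum, hw1, hw1']
    ring
  · filter_upwards [h, h'] with t ht ht'
    rw [mix_kernel, ht, ht', Finset.smul_sum, Finset.smul_sum, ← Finset.sum_add_distrib]
    refine Finset.sum_congr rfl fun i _ => ?_
    rw [ENNReal.ofReal_add (mul_nonneg h2 (hw0 i t)) (mul_nonneg h0 (hw0' i t)),
      ENNReal.ofReal_mul h2, ENNReal.ofReal_mul h0, add_smul, mul_smul, mul_smul]

end RelaxedInput

/-- The derivative `∫ p t • (∫ F (t, x t, u) dμ'_t - ∫ F (t, x t, u) dμ_t) dt` of the cost at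
`y = (x, μ)` in the direction of `μ'`. -/
def descent (F : P.Time × RVec n × RVec m → RVec n) (y : P.Pair) (μ' : P.RelaxedInput) : ℝ :=
  ∫ t, inner ℝ (P.costate y t) (μ'.avg (fun q => F (q.1, y.1 q.1, q.2)) t
    - y.2.avg (fun q => F (q.1, y.1 q.1, q.2)) t)

/-- Integration by parts for primitives of integrable functions. -/
theorem inner_integral_eq {D q : P.Time → RVec n} (hD : Integrable D) (hq : Integrable q)
    {c : RVec n} {p Δ : C(P.Time, RVec n)} (hp : ∀ t, p t = c + ∫ s in Set.Ici t, q s)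
    (hΔ : ∀ t, Δ t = ∫ s in Set.Iic t, D s) :
    inner ℝ c (Δ P.finalTime) = (∫ t, inner ℝ (p t) (D t)) - ∫ t, inner ℝ (q t) (Δ t) := by
  have huniv : (Set.Iic P.finalTime : Set P.Time) = Set.univ :=
    Set.eq_univ_of_forall fun t => t.2.2
  have hS : MeasurableSet {z : P.Time × P.Time | z.1 ≤ z.2} :=
    measurableSet_le measurable_fst measurable_snd
  have hint : Integrable (fun z : P.Time × P.Time => inner ℝ (q z.2) (D z.1))
      ((volume : Measure P.Time).prod volume) := by
    refine (hD.norm.mul_prod hq.norm).mono' (hq.1.comp_snd.inner hD.1.comp_fst)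
      (.of_forall fun z => ?_)
    rw [mul_comm]
    exact norm_inner_le_norm _ _
  -- Fubini on the triangle `t ≤ s` replaces differentiation of `p` and `Δ`.
  have hswap := integral_integral_swap (f := fun t s =>
    {z : P.Time × P.Time | z.1 ≤ z.2}.indicator (fun z => inner ℝ (q z.2) (D z.1)) (t, s))
    (hint.indicator hS)
  have e1 : ∀ t, ∫ s, {z : P.Time × P.Time | z.1 ≤ z.2}.indicator
      (fun z => inner ℝ (q z.2) (D z.1)) (t, s) = inner ℝ (p t - c) (D t) := fun t => by
    rw [hp t, add_sub_cancel_left, real_inner_comm, ← integral_inner hq.integrableOn,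
      ← integral_indicator measurableSet_Ici]
    refine integral_congr_ae (.of_forall fun s => ?_)
    simp [Set.indicator, real_inner_comm]
  have e2 : ∀ s, ∫ t, {z : P.Time × P.Time | z.1 ≤ z.2}.indicator
      (fun z => inner ℝ (q z.2) (D z.1)) (t, s) = inner ℝ (q s) (Δ s) := fun s => by
    rw [hΔ s, ← integral_inner hD.integrableOn, ← integral_indicator measurableSet_Iic]
    refine integral_congr_ae (.of_forall fun t => ?_)
    simp [Set.indicator]
  simp_rw [e1, e2, inner_sub_left] at hswap
  have hpD : Integrable fun t => inner ℝ (p t) (D t) := by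
    refine (hD.norm.const_mul ‖p‖).mono' (p.continuous.aestronglyMeasurable.inner hD.1)
      (.of_forall fun t => ?_)
    exact (norm_inner_le_norm _ _).trans
      (mul_le_mul_of_nonneg_right (p.norm_coe_le_norm t) (norm_nonneg _))
  rw [integral_sub hpD (hD.const_inner c), integral_inner hD] at hswap
  rw [← hswap, hΔ, huniv, Measure.restrict_univ]
  ring

namespace IsExtension

variable {F : P.Time × RVec n × RVec m → RVec n}
  {G : P.Time × RVec n × RVec m → (RVec n →L[ℝ] RVec n)} {L : ℝ}

/-- Along the old trajectory, mixing changes the averaged field by `ε` times a difference of two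
averages, at most `2 * B * ε`. Grönwall carries this over to the state with a constant independent
of `ε`. -/
theorem norm_trajectory_mix_sub_le (h : P.IsExtension F G L) {y : P.Pair}
    (hy : P.IsTrajectory y.1 y.2) (μ' : P.RelaxedInput) :
    ∃ K, 0 ≤ K ∧ ∀ ε (h0 : 0 ≤ ε) (h1 : ε ≤ 1) (x : C(P.Time, RVec n)),
      P.IsTrajectory x (y.2.mix μ' ε h0 h1) → ∀ t, ‖x t - y.1 t‖ ≤ K * ε := by
  obtain ⟨C, hC0, hC⟩ := P.isVolterra_Iic.gronwall (vol := (volume : Measure P.Time)) h.pos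
  have hφ := h.isLipField_F.continuous_comp y.1
  obtain ⟨B, hB0, hB⟩ := P.exists_bound_of_continuous hφ
  set V := volume.real (Set.univ : Set P.Time) with hV
  have hV0 : 0 ≤ V := measureReal_nonneg
  set φ : P.Time × RVec m → RVec n := fun q => F (q.1, y.1 q.1, q.2) with hφe
  refine ⟨C * (2 * B * V), by positivity, fun ε h0 h1 x hx => ?_⟩
  have hψ := h.isLipField_F.continuous_comp x
  set ψ : P.Time × RVec m → RVec n := fun q => F (q.1, x q.1, q.2) with hψe
  rw [h.isTrajectory_iff] at hx hy
  intro t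
  rw [mul_assoc C]
  refine hC ⟨fun t => ‖x t - y.1 t‖, by fun_prop⟩ _ (by positivity)
    (fun t => norm_nonneg (x t - y.1 t)) (fun t => ?_) t
  simp only [ContinuousMap.coe_mk]
  have i3 : Integrable (fun s => L * ‖x s - y.1 s‖) (volume : Measure P.Time) :=
    (ContinuousMap.integrable_of_compactSpace ⟨fun t => ‖x t - y.1 t‖, by fun_prop⟩
      volume).const_mul L
  rw [hx t, hy t, add_sub_add_left_eq_sub,
    ← integral_sub (RelaxedInput.integrable_avg _ hψ).integrableOn
      (RelaxedInput.integrable_avg _ hφ).integrableOn]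
  have h4 : ‖∫ s in Set.Iic t, ((y.2.mix μ' ε h0 h1).avg ψ s
      - y.2.avg φ s)‖
        ≤ ∫ s in Set.Iic t, (L * ‖x s - y.1 s‖ + ε * (2 * B)) := by
    refine norm_integral_le_of_norm_le (i3.add (integrable_const _)).integrableOn ?_
    filter_upwards [ae_restrict_of_ae
      ((y.2.mix μ' ε h0 h1).ae_norm_avg_sub_avg_le (E := RVec n)),
      ae_restrict_of_ae (RelaxedInput.ae_avg_mix (μ := y.2) (μ' := μ') (h0 := h0) (h1 := h1)
        (E := RVec n)), ae_restrict_of_ae (y.2.ae_norm_avg_le (E := RVec n)),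
      ae_restrict_of_ae (μ'.ae_norm_avg_le (E := RVec n))] with s a1 a2 a3 a4
    have b1 : ‖(y.2.mix μ' ε h0 h1).avg ψ s - (y.2.mix μ' ε h0 h1).avg φ s‖
        ≤ L * ‖x s - y.1 s‖ := a1 ψ φ hψ hφ (L * ‖x s - y.1 s‖) (h.lip_F s (x s) (y.1 s))
    have b2 := a2 φ hφ
    have b3 := a3 φ B (hB s)
    have b4 := a4 φ B (hB s)
    have e : (y.2.mix μ' ε h0 h1).avg ψ s
        - y.2.avg φ s
        = ((y.2.mix μ' ε h0 h1).avg ψ s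
          - (y.2.mix μ' ε h0 h1).avg φ s)
        + ε • (μ'.avg φ s
          - y.2.avg φ s) := by
      rw [b2]; module
    rw [e]
    refine (norm_add_le _ _).trans (add_le_add b1 ?_)
    rw [norm_smul, Real.norm_of_nonneg h0]
    refine mul_le_mul_of_nonneg_left ((norm_sub_le _ _).trans ?_) h0
    linarith
  rw [integral_add i3.integrableOn (integrable_const _), integral_const_mul,
    setIntegral_const, smul_eq_mul] at h4
  have h5 : volume.real (Set.Iic t) * (ε * (2 * B)) ≤ V * (ε * (2 * B)) :=
    mul_le_mul_of_nonneg_right (measureReal_mono (Set.subset_univ _)) (by positivity)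
  linarith

/-- Integration by parts rewrites `∇Ψ · Δ(T)` through the costate, and the adjoint equation cancels
the part of `ẋ - ẏ` linear in `Δ`. What remains is `ε * descent F y μ'` up to second-order terms. -/
theorem abs_cost_mix_sub_le (h : P.IsExtension F G L) {y : P.Pair}
    (hy : P.IsTrajectory y.1 y.2) (μ' : P.RelaxedInput) :
    ∃ C, 0 ≤ C ∧ ∀ ε (h0 : 0 ≤ ε) (h1 : ε ≤ 1) (x : C(P.Time, RVec n)),
      P.IsTrajectory x (y.2.mix μ' ε h0 h1) →
      |P.Ψ (x P.finalTime) - P.Ψ (y.1 P.finalTime) - ε * descent F y μ'| ≤ C * ε ^ 2 := by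
  obtain ⟨K, hK0, hK⟩ := h.norm_trajectory_mix_sub_le hy μ'
  have hp := h.isSolution_costate y
  set p := P.costate y with hpe
  have hφ := h.isLipField_F.continuous_comp y.1
  set φ : P.Time × RVec m → RVec n := fun q => F (q.1, y.1 q.1, q.2) with hφe
  have hα := (h.isLipField_adjointField y.1).continuous_comp p
  set α : P.Time × RVec m → RVec n := fun q => adjointField G y.1 (q.1, p q.1, q.2) with hαe
  set V := volume.real (Set.univ : Set P.Time) with hV
  have hV0 : 0 ≤ V := measureReal_nonneg
  have hL := h.pos
  rw [h.isTrajectory_iff] at hy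
  -- The first `L * K ^ 2` is the Taylor remainder of `Ψ`, the second that of `F`. The term `2 * (L
  -- * K)` comes from evaluating the `ε`-weighted averages along the old trajectory instead of the
  -- new one.
  refine ⟨L * K ^ 2 + ‖p‖ * (L * K ^ 2 + 2 * (L * K)) * V, by positivity,
    fun ε h0 h1 x hx => ?_⟩
  specialize hK ε h0 h1 x hx
  rw [h.isTrajectory_iff] at hx
  have hψ := h.isLipField_F.continuous_comp x
  set ψ : P.Time × RVec m → RVec n := fun q => F (q.1, x q.1, q.2) with hψe
  set Δ : C(P.Time, RVec n) := x - y.1 with hΔe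
  have hχ : Continuous fun q : P.Time × RVec m => G (q.1, y.1 q.1, q.2) (Δ q.1) :=
    (h.continuous_G.comp (by fun_prop : Continuous fun q : P.Time × RVec m =>
      (q.1, y.1 q.1, q.2))).clm_apply (by fun_prop)
  set χ : P.Time × RVec m → RVec n := fun q => G (q.1, y.1 q.1, q.2) (Δ q.1) with hχe
  set D : P.Time → RVec n := fun t => (y.2.mix μ' ε h0 h1).avg ψ t - y.2.avg φ t with hDe
  have hD : Integrable D :=
    (RelaxedInput.integrable_avg _ hψ).sub (RelaxedInput.integrable_avg _ hφ)
  have hΔ : ∀ t, Δ t = ∫ s in Set.Iic t, D s := fun t => by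
    rw [hΔe, ContinuousMap.sub_apply, hx t, hy t, add_sub_add_left_eq_sub,
      ← integral_sub (RelaxedInput.integrable_avg _ hψ).integrableOn
        (RelaxedInput.integrable_avg _ hφ).integrableOn]
  have hq : Integrable (y.2.avg α) := y.2.integrable_avg hα
  have hparts := inner_integral_eq hD hq hp hΔ
  have ip : ∀ {g : P.Time → RVec n}, Integrable g → Integrable fun t => inner ℝ (p t) (g t) := by
    intro g hg
    refine (hg.norm.const_mul ‖p‖).mono' (p.continuous.aestronglyMeasurable.inner hg.1)
      (.of_forall fun t => ?_)
    exact (norm_inner_le_norm _ _).trans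
      (mul_le_mul_of_nonneg_right (p.norm_coe_le_norm t) (norm_nonneg _))
  have iqΔ : Integrable fun t => inner ℝ (y.2.avg α t) (Δ t) := by
    refine (hq.norm.mul_const ‖Δ‖).mono' (hq.1.inner Δ.continuous.aestronglyMeasurable)
      (.of_forall fun t => ?_)
    exact (norm_inner_le_norm _ _).trans
      (mul_le_mul_of_nonneg_left (Δ.norm_coe_le_norm t) (norm_nonneg _))
  have ib : Integrable fun t => inner ℝ (p t) (μ'.avg φ t - y.2.avg φ t) :=
    ip ((μ'.integrable_avg hφ).sub (y.2.integrable_avg hφ))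
  have hmain : |inner ℝ (gradient P.Ψ (y.1 P.finalTime)) (Δ P.finalTime) - ε * descent F y μ'|
      ≤ ‖p‖ * (L * K ^ 2 + 2 * (L * K)) * V * ε ^ 2 := by
    have hdes : descent F y μ' = ∫ t, inner ℝ (p t) (μ'.avg φ t - y.2.avg φ t) := rfl
    have iDΔ : Integrable fun t => inner ℝ (p t) (D t) - inner ℝ (y.2.avg α t) (Δ t) :=
      (ip hD).sub iqΔ
    rw [hparts, hdes, ← integral_const_mul, ← integral_sub (ip hD) iqΔ,
      ← integral_sub iDΔ (ib.const_mul ε), ← Real.norm_eq_abs]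
    have := norm_integral_le_of_norm_le_const (μ := (volume : Measure P.Time))
      (f := fun t => inner ℝ (p t) (D t) - inner ℝ (y.2.avg α t) (Δ t)
        - ε * inner ℝ (p t) (μ'.avg φ t - y.2.avg φ t))
      (C := ‖p‖ * ((L * K ^ 2 + 2 * (L * K)) * ε ^ 2)) ?_
    · refine this.trans (le_of_eq ?_)
      rw [hV]; ring
    filter_upwards [y.2.ae_integrable (E := RVec n), y.2.ae_norm_avg_le (E := RVec n),
      y.2.ae_avg_sub (E := RVec n), y.2.ae_norm_avg_sub_avg_le (E := RVec n),
      μ'.ae_norm_avg_sub_avg_le (E := RVec n),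
      RelaxedInput.ae_avg_mix (μ := y.2) (μ' := μ') (h0 := h0) (h1 := h1) (E := RVec n)]
      with t a1 a2 a3 a4 a5 a6
    have e1 : inner ℝ (y.2.avg α t) (Δ t) = inner ℝ (p t) (y.2.avg χ t) := by
      rw [real_inner_comm, RelaxedInput.avg, RelaxedInput.avg, ← integral_inner (a1 α hα),
        ← integral_inner (a1 χ hχ)]
      refine integral_congr_ae (.of_forall fun u => ?_)
      change inner ℝ (Δ t) (ContinuousLinearMap.adjoint (G (t, y.1 t, u)) (p t))
        = inner ℝ (p t) (G (t, y.1 t, u) (Δ t))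
      rw [ContinuousLinearMap.adjoint_inner_right, real_inner_comm]
    have e2 : inner ℝ (p t) (D t) - inner ℝ (y.2.avg α t) (Δ t)
        - ε * inner ℝ (p t) (μ'.avg φ t - y.2.avg φ t)
        = inner ℝ (p t) (y.2.avg (fun q => ψ q - φ q - χ q) t - ε • (y.2.avg ψ t - y.2.avg φ t)
          + ε • (μ'.avg ψ t - μ'.avg φ t)) := by
      have e4 : y.2.avg (fun q => ψ q - φ q - χ q) t - ε • (y.2.avg ψ t - y.2.avg φ t)
          + ε • (μ'.avg ψ t - μ'.avg φ t)
          = D t - y.2.avg χ t - ε • (μ'.avg φ t - y.2.avg φ t) := by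
        rw [a3 (fun q => ψ q - φ q) χ (hψ.sub hφ) hχ, a3 ψ φ hψ hφ, hDe]
        dsimp only
        rw [a6 ψ hψ]
        module
      have e5 := inner_sub_right (𝕜 := ℝ) (p t) (D t) (y.2.avg χ t)
      rw [e1, e4, inner_sub_right _ _ (ε • _), inner_smul_right, e5]
    rw [e2]
    have hΔt : ‖Δ t‖ ≤ K * ε := hK t
    refine (norm_inner_le_norm _ _).trans (mul_le_mul (p.norm_coe_le_norm t) ?_ (norm_nonneg _)
      (norm_nonneg _))
    have c1 : ‖y.2.avg (fun q => ψ q - φ q - χ q) t‖ ≤ L * (K * ε) ^ 2 := by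
      refine a2 _ _ fun u hu => (h.taylor_F t (y.1 t) (x t) u hu).trans ?_
      exact mul_le_mul_of_nonneg_left (pow_le_pow_left₀ (norm_nonneg _) hΔt 2) hL.le
    have c0 : ∀ u ∈ P.U, ‖ψ (t, u) - φ (t, u)‖ ≤ L * (K * ε) := fun u hu =>
      (h.lip_F t (x t) (y.1 t) u hu).trans (mul_le_mul_of_nonneg_left hΔt hL.le)
    have c2 := a4 ψ φ hψ hφ _ c0
    have c3 := a5 ψ φ hψ hφ _ c0
    refine (norm_add_le _ _).trans (le_trans (add_le_add_left (norm_sub_le _ _) _) ?_)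
    rw [norm_smul, norm_smul, Real.norm_of_nonneg h0]
    have c4 := mul_le_mul_of_nonneg_left c2 h0
    have c5 := mul_le_mul_of_nonneg_left c3 h0
    nlinarith
  have htaylor := h.taylor_cost (y.1 P.finalTime) (x P.finalTime)
  have hΔT : ‖x P.finalTime - y.1 P.finalTime‖ ^ 2 ≤ (K * ε) ^ 2 :=
    pow_le_pow_left₀ (norm_nonneg _) (hK P.finalTime) 2
  have hΔT' := mul_le_mul_of_nonneg_left hΔT hL.le
  have e3 : Δ P.finalTime = x P.finalTime - y.1 P.finalTime := rfl
  rw [e3] at hmain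
  rw [abs_le] at htaylor hmain ⊢
  constructor <;> nlinarith [htaylor.1, htaylor.2, hmain.1, hmain.2]

/-- First-order optimality: if the cost cannot be decreased along the segment from `μ` to `μ'`, then
the derivative of the cost in this direction is nonnegative. -/
theorem descent_nonneg (h : P.IsExtension F G L) {y : P.Pair} (hy : P.IsTrajectory y.1 y.2)
    (μ' : P.RelaxedInput)
    (hmin : ∀ ε (h0 : 0 ≤ ε) (h1 : ε ≤ 1) (x : C(P.Time, RVec n)),
      P.IsTrajectory x (y.2.mix μ' ε h0 h1) → P.Ψ (y.1 P.finalTime) ≤ P.Ψ (x P.finalTime)) :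
    0 ≤ descent F y μ' := by
  obtain ⟨C, hC0, hC⟩ := h.abs_cost_mix_sub_le hy μ'
  by_contra! hneg
  set d := descent F y μ' with hd
  -- For this `ε` the quadratic error is at most half of the first-order gain, so a negative `d`
  -- would lower the cost strictly.
  set ε := min 1 (-d / (2 * (C + 1))) with hε
  have hε0 : 0 < ε := lt_min one_pos (div_pos (by linarith) (by positivity))
  have hε1 : ε ≤ 1 := min_le_left _ _
  have hε2 : ε * (2 * (C + 1)) ≤ -d := by
    rw [← le_div_iff₀ (by positivity)]
    exact min_le_right _ _
  obtain ⟨x, hx, -⟩ := h.existsUnique_trajectory (y.2.mix μ' ε hε0.le hε1)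
  have h1 := hmin ε hε0.le hε1 x hx
  have h2 := (abs_le.1 (hC ε hε0.le hε1 x hx)).2
  nlinarith [mul_le_mul_of_nonneg_left hε2 hε0.le, mul_pos hε0 hε0]

end IsExtension

end ControlProblem

/-! ### Differences of finite measures as signed measures -/

section SignedMeasure

variable {α : Type*} [MeasurableSpace α]

theorem exists_toSignedMeasure_eq {s : SignedMeasure α} (hs : 0 ≤ s) :
    ∃ (ρ : Measure α) (_ : IsFiniteMeasure ρ), ρ.toSignedMeasure = s :=
  ⟨_, _, SignedMeasure.toMeasureOfZeroLE_toSignedMeasure _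
    ((VectorMeasure.le_restrict_univ_iff_le _ _).2 hs)⟩

theorem totalVariation_toSignedMeasure (ρ : Measure α) [IsFiniteMeasure ρ] :
    ρ.toSignedMeasure.totalVariation = ρ := by
  have h := Measure.toJordanDecomposition_toSignedMeasure_sub (μ := ρ) (ν := 0)
  rw [Measure.toSignedMeasure_zero, sub_zero] at h
  rw [SignedMeasure.totalVariation, h, Measure.jordanDecompositionOfToSignedMeasureSub_posPart,
    Measure.jordanDecompositionOfToSignedMeasureSub_negPart, Measure.sub_zero,
    Measure.zero_sub, add_zero]

theorem totalVariation_sub_le (ρ κ : Measure α) [IsFiniteMeasure ρ] [IsFiniteMeasure κ] :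
    (ρ.toSignedMeasure - κ.toSignedMeasure).totalVariation ≤ ρ + κ := by
  rw [SignedMeasure.totalVariation, Measure.toJordanDecomposition_toSignedMeasure_sub,
    Measure.jordanDecompositionOfToSignedMeasureSub_posPart,
    Measure.jordanDecompositionOfToSignedMeasureSub_negPart]
  exact add_le_add Measure.sub_le Measure.sub_le

theorem signedSupport_toSignedMeasure {m : ℕ} (ρ : Measure (RVec m)) [IsFiniteMeasure ρ] :
    signedSupport ρ.toSignedMeasure = ρ.support := by
  rw [signedSupport, totalVariation_toSignedMeasure]

/-- The Jordan parts are the truncated differences `ρ - κ` and `κ - ρ`. Integrating the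
cancellation-free identity `ρ + (κ - ρ) = κ + (ρ - κ)` gives the claim. -/
theorem signedIntegral_sub {m n : ℕ} (ρ κ : Measure (RVec m)) [IsFiniteMeasure ρ]
    [IsFiniteMeasure κ] {g : RVec m → RVec n} (hρ : Integrable g ρ) (hκ : Integrable g κ) :
    signedIntegral (ρ.toSignedMeasure - κ.toSignedMeasure) g = (∫ u, g u ∂ρ) - ∫ u, g u ∂κ := by
  rw [signedIntegral, Measure.toJordanDecomposition_toSignedMeasure_sub,
    Measure.jordanDecompositionOfToSignedMeasureSub_posPart,
    Measure.jordanDecompositionOfToSignedMeasureSub_negPart]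
  have h : ρ + (κ - ρ) = κ + (ρ - κ) := by
    have h0 := Measure.sub_toSignedMeasure_eq_toSignedMeasure_sub (μ := ρ) (ν := κ)
    rw [sub_eq_sub_iff_add_eq_add] at h0
    rw [← Measure.toSignedMeasure_eq_toSignedMeasure_iff, Measure.toSignedMeasure_add,
      Measure.toSignedMeasure_add, h0, add_comm]
  have h1 : ∫ u, g u ∂(ρ + (κ - ρ)) = ∫ u, g u ∂(κ + (ρ - κ)) := by rw [h]
  rw [integral_add_measure hρ (hκ.mono_measure Measure.sub_le),
    integral_add_measure hκ (hρ.mono_measure Measure.sub_le)] at h1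
  rw [sub_eq_sub_iff_add_eq_add, h1, add_comm]

end SignedMeasure

/-! ### Nearest sample points -/

theorem exists_measurable_nearest {m N : ℕ} (hN : 0 < N) (v : Fin N → RVec m) :
    ∃ ind : RVec m → Fin N, Measurable ind ∧ ∀ x i, dist (v (ind x)) x ≤ dist (v i) x := by
  -- `nearestPtInd` searches a sequence over the indices `0, …, N - 1`, its bound being inclusive.
  -- Clamping extends the finite family to such a sequence.
  let c : ℕ → Fin N := fun k => ⟨min k (N - 1), by omega⟩
  refine ⟨fun x => c (SimpleFunc.nearestPtInd (v ∘ c) (N - 1) x),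
    (Measurable.of_discrete (f := c)).comp (SimpleFunc.nearestPtInd (v ∘ c) (N - 1)).measurable,
    fun x i => ?_⟩
  have h := SimpleFunc.edist_nearestPt_le (v ∘ c) x (k := i) (N := N - 1) (by omega)
  have hc : c i = i := Fin.ext (by simp only [c]; omega)
  rw [Function.comp_apply, hc, edist_dist, edist_dist, ENNReal.ofReal_le_ofReal_iff dist_nonneg]
    at h
  exact h

theorem map_comp_eq_sum_dirac {α β : Type*} [MeasurableSpace α] [MeasurableSpace β] {N : ℕ}
    {v : Fin N → β} {ind : α → Fin N} (hind : Measurable ind) (κ : Measure α)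
    [IsFiniteMeasure κ] : κ.map (v ∘ ind)
      = ∑ i, ENNReal.ofReal (κ.real (ind ⁻¹' {i})) • Measure.dirac (v i) := by
  have hv : Measurable v := measurable_from_top
  rw [← Measure.map_map hv hind, ← Measure.sum_smul_dirac (κ.map ind), Measure.sum_fintype]
  ext s hs
  rw [Measure.map_apply hv hs]
  simp only [Measure.coe_finsetSum, Finset.sum_apply, Measure.smul_apply, smul_eq_mul,
    Measure.dirac_apply' _ hs, Measure.dirac_apply' _ (hv hs)]
  refine Finset.sum_congr rfl fun i _ => ?_
  rw [Measure.map_apply hind (measurableSet_singleton i), ofReal_measureReal]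
  rfl

namespace ControlProblem

variable {n m : ℕ} {P : ControlProblem n m}

theorem IsEmpirical.ae_compl_range {N : ℕ} {v : Fin N → RVec m} {μ : P.RelaxedInput}
    (hμ : P.IsEmpirical v μ) : ∀ᵐ t, μ.kernel t (Set.range v)ᶜ = 0 := by
  obtain ⟨w, -, -, -, h⟩ := hμ
  filter_upwards [h] with t ht
  rw [ht]
  simp [Measure.dirac_apply' _ (Set.finite_range v).measurableSet.compl]

theorem IsEmpirical.pos {N : ℕ} {v : Fin N → RVec m} {μ : P.RelaxedInput}
    (hμ : P.IsEmpirical v μ) : 0 < N := by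
  obtain ⟨w, -, -, h, -⟩ := hμ
  rcases Nat.eq_zero_or_pos N with rfl | h'
  · simpa using h P.finalTime
  · exact h'

theorem sum_measureReal_preimage {α : Type*} [MeasurableSpace α] {N : ℕ} {ind : α → Fin N}
    (hind : Measurable ind) (κ : Measure α) [IsProbabilityMeasure κ] :
    ∑ i, κ.real (ind ⁻¹' {i}) = 1 := by
  have := sum_measureReal_preimage_singleton (μ := κ) (f := ind) Finset.univ
    (fun i _ => hind (measurableSet_singleton i))
  simpa using this

/-- The weights are the masses of the nearest-point cells, hence measurable in time. A single index
is selected per point, so coinciding samples are not counted twice. -/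
theorem isEmpirical_of_ae_compl_range {N : ℕ} (hN : 0 < N) {v : Fin N → RVec m}
    {μ : P.RelaxedInput} (hμ : ∀ᵐ t, μ.kernel t (Set.range v)ᶜ = 0) : P.IsEmpirical v μ := by
  obtain ⟨ind, hind, hnear⟩ := exists_measurable_nearest hN v
  refine ⟨fun i t => (μ.kernel t).real (ind ⁻¹' {i}),
    fun i => (μ.kernel.measurable_coe (hind (measurableSet_singleton i))).ennreal_toReal,
    fun i t => measureReal_nonneg, fun t => sum_measureReal_preimage hind _, ?_⟩
  filter_upwards [hμ] with t ht
  rw [← map_comp_eq_sum_dirac hind]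
  have h : v ∘ ind =ᵐ[μ.kernel t] id := by
    filter_upwards [mem_ae_iff.2 ht] with x hx
    obtain ⟨i, rfl⟩ := hx
    have := hnear (v i) i
    rw [dist_self] at this
    exact dist_le_zero.1 this
  rw [Measure.map_congr h, Measure.map_id]

/-! ### Variations as differences of relaxed inputs -/

/-- The variation `μ' - μ`. -/
def variation (μ μ' : P.RelaxedInput) (t : P.Time) : SignedMeasure (RVec m) :=
  (μ'.kernel t).toSignedMeasure - (μ.kernel t).toSignedMeasure

theorem isVariation_variation (μ μ' : P.RelaxedInput) : P.IsVariation μ (variation μ μ') where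
  measurable B hB := by
    simp only [variation, Measure.toSignedMeasure_sub_apply hB]
    exact (μ'.kernel.measurable_coe hB).ennreal_toReal.sub
      (μ.kernel.measurable_coe hB).ennreal_toReal
  nonneg := .of_forall fun t => by
    rw [variation, sub_add_cancel]
    exact Measure.zero_le_toSignedMeasure _
  mass_zero := .of_forall fun t => by
    rw [variation, Measure.toSignedMeasure_sub_apply .univ]
    simp

theorem signedSupport_variation_subset {μ μ' : P.RelaxedInput} {N : ℕ} {v : Fin N → RVec m}
    (hμ : P.IsEmpirical v μ) (hμ' : P.IsEmpirical v μ') :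
    ∀ᵐ t, signedSupport (variation μ μ' t) ⊆ Set.range v := by
  filter_upwards [hμ.ae_compl_range, hμ'.ae_compl_range] with t ht ht'
  refine Measure.support_subset_of_isClosed (Set.finite_range v).isClosed (mem_ae_iff.2 ?_)
  refine le_antisymm ((totalVariation_sub_le _ _ _).trans ?_) bot_le
  simp [ht, ht']

/-- The input sought is `δ + μ`. It is a probability measure on `U` only at almost every time, while
a Markov kernel is needed at every time, so `μ` is kept on a null set. -/
theorem IsVariation.exists_relaxedInput {μ : P.RelaxedInput}
    {δ : P.Time → SignedMeasure (RVec m)} (hδ : P.IsVariation μ δ)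
    (hU : ∀ᵐ t, signedSupport (δ t + (μ.kernel t).toSignedMeasure) ⊆ P.U) :
    ∃ μ' : P.RelaxedInput, ∀ᵐ t, δ t = variation μ μ' t := by
  classical
  set good : P.Time → Prop := fun t => 0 ≤ δ t + (μ.kernel t).toSignedMeasure ∧
    δ t Set.univ = 0 ∧ signedSupport (δ t + (μ.kernel t).toSignedMeasure) ⊆ P.U with hgood
  have hg : ∀ᵐ t, good t := by
    filter_upwards [hδ.nonneg, hδ.mass_zero, hU] with t h1 h2 h3 using ⟨h1, h2, h3⟩
  -- The set of bad times need not be measurable. Its measurable hull is still null and keeps the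
  -- patched kernel measurable.
  set S := toMeasurable volume {t | ¬ good t} with hS
  have hSm : MeasurableSet S := measurableSet_toMeasurable _ _
  have hS0 : volume S = 0 := by rw [hS, measure_toMeasurable]; exact hg
  have hSg : ∀ t, t ∉ S → good t := fun t ht => by
    by_contra h
    exact ht (subset_toMeasurable _ _ h)
  have hρ : ∀ t, ∃ ρ : Measure (RVec m), IsProbabilityMeasure ρ ∧
      (t ∈ S → ρ = μ.kernel t) ∧
      (t ∉ S → (∀ B, MeasurableSet B → ρ B = ENNReal.ofReal (δ t B + (μ.kernel t).real B)) ∧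
        ρ P.Uᶜ = 0) := by
    intro t
    by_cases ht : t ∈ S
    · exact ⟨μ.kernel t, inferInstance, fun _ => rfl, fun h => absurd ht h⟩
    obtain ⟨h1, h2, h3⟩ := hSg t ht
    obtain ⟨ρ, hfin, hρ⟩ := exists_toSignedMeasure_eq h1
    have hB : ∀ B, MeasurableSet B → ρ B = ENNReal.ofReal (δ t B + (μ.kernel t).real B) := by
      intro B hB
      have := congrArg (fun s => s B) hρ
      simp only [_root_.add_apply, Measure.toSignedMeasure_apply_measurable hB] at this
      rw [← this, ofReal_measureReal]
    refine ⟨ρ, ⟨by rw [hB _ .univ, h2]; simp⟩, fun h => absurd h ht, fun _ => ⟨hB, ?_⟩⟩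
    rw [← hρ, signedSupport_toSignedMeasure] at h3
    exact mem_of_superset Measure.support_mem_ae h3
  choose ρ hρ1 hρ2 hρ3 using hρ
  have hmeas : Measurable ρ := by
    refine Measure.measurable_of_measurable_coe _ fun B hB => ?_
    have : (fun t => ρ t B) = S.piecewise (fun t => μ.kernel t B)
        (fun t => ENNReal.ofReal (δ t B + (μ.kernel t).real B)) := by
      ext t
      by_cases ht : t ∈ S
      · simp [ht, hρ2 t ht]
      · simp [ht, (hρ3 t ht).1 B hB]
    rw [this]
    exact (μ.kernel.measurable_coe hB).piecewise hSm
      ((hδ.measurable B hB).add (μ.kernel.measurable_coe hB).ennreal_toReal).ennreal_ofReal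
  have hae : ∀ᵐ t, t ∉ S := measure_eq_zero_iff_ae_notMem.1 hS0
  refine ⟨RelaxedInput.ofKernel ⟨ρ, hmeas⟩ ⟨hρ1⟩ ?_, ?_⟩
  · filter_upwards [hae] with t ht using (hρ3 t ht).2
  · filter_upwards [hae] with t ht
    ext B hB
    rw [variation, Measure.toSignedMeasure_sub_apply hB]
    have h1 : (ρ t).real B = δ t B + (μ.kernel t).real B := by
      rw [measureReal_def, (hρ3 t ht).1 B hB, ENNReal.toReal_ofReal]
      have := (VectorMeasure.le_iff.1 (hSg t ht).1) B hB
      simpa [_root_.add_apply, Measure.toSignedMeasure_apply_measurable hB] using this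
    change δ t B = (ρ t).real B - _
    rw [h1, add_sub_cancel_right]

/-- A variation that is concentrated on `U` leads to relaxed inputs that are concentrated
on `U`. -/
theorem IsVariation.ae_signedSupport_add_subset {μ : P.RelaxedInput}
    {δ : P.Time → SignedMeasure (RVec m)} (hδ : P.IsVariation μ δ)
    (hU : ∀ᵐ t, signedSupport (δ t) ⊆ P.U) :
    ∀ᵐ t, signedSupport (δ t + (μ.kernel t).toSignedMeasure) ⊆ P.U := by
  filter_upwards [hδ.nonneg, hU, μ.ae_compl_eq_zero] with t h1 h2 h3
  obtain ⟨ρ, hfin, hρ⟩ := exists_toSignedMeasure_eq h1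
  rw [← hρ, signedSupport_toSignedMeasure]
  refine Measure.support_subset_of_isClosed P.isCompact_U.isClosed (mem_ae_iff.2 ?_)
  have hUm : MeasurableSet P.Uᶜ := P.isCompact_U.isClosed.measurableSet.compl
  have h4 : (δ t).totalVariation P.Uᶜ = 0 :=
    mem_of_superset (Measure.support_mem_ae (μ := (δ t).totalVariation)) h2
  have h5 := congrArg (fun s => s P.Uᶜ) hρ
  simp only [_root_.add_apply, Measure.toSignedMeasure_apply_measurable hUm,
    SignedMeasure.null_of_totalVariation_zero _ h4, measureReal_def, h3] at h5
  simpa [ENNReal.toReal_eq_zero_iff] using h5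

/-- Variations that are concentrated on the samples join empirical inputs. -/
theorem IsVariation.exists_empirical {N : ℕ} {v : Fin N → RVec m} (hv : ∀ i, v i ∈ P.U)
    {μ : P.RelaxedInput} (hμ : P.IsEmpirical v μ) {δ : P.Time → SignedMeasure (RVec m)}
    (hδ : P.IsVariation μ δ) (hU : ∀ᵐ t, signedSupport (δ t) ⊆ Set.range v) :
    ∃ μ' : P.RelaxedInput, P.IsEmpirical v μ' ∧ ∀ᵐ t, δ t = variation μ μ' t := by
  obtain ⟨μ', h⟩ := hδ.exists_relaxedInput (hδ.ae_signedSupport_add_subset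
    (hU.mono fun t ht => ht.trans (Set.range_subset_iff.2 hv)))
  refine ⟨μ', isEmpirical_of_ae_compl_range hμ.pos ?_, h⟩
  filter_upwards [h, hU, hμ.ae_compl_range] with t h1 h2 h3
  have hm : MeasurableSet (Set.range v)ᶜ := (Set.finite_range v).measurableSet.compl
  have h4 : (δ t).totalVariation (Set.range v)ᶜ = 0 :=
    mem_of_superset (Measure.support_mem_ae (μ := (δ t).totalVariation)) h2
  have h5 := SignedMeasure.null_of_totalVariation_zero _ h4
  rw [h1, variation, Measure.toSignedMeasure_sub_apply hm, measureReal_def, measureReal_def,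
    h3] at h5
  simpa [ENNReal.toReal_eq_zero_iff] using h5

/-! ### Comparison of the optimality functions -/

theorem hamiltonianValue_mono {y : P.Pair} {C C' : (P.Time → SignedMeasure (RVec m)) → Prop}
    (h : ∀ δ, P.IsVariation y.2 δ → C' δ → C δ) :
    P.hamiltonianValue y C ≤ P.hamiltonianValue y C' :=
  le_iInf₂ fun δ hδ => iInf₂_le δ ⟨hδ.1, h δ hδ.1 hδ.2⟩

theorem thetaH_le_thetaNH (y : P.Pair) : P.thetaH y ≤ P.thetaNH y :=
  hamiltonianValue_mono fun _ hδ h => hδ.ae_signedSupport_add_subset (by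
    filter_upwards [h, y.2.support_subset] with t h1 h2 using h1.trans h2)

theorem thetaH_le_thetaSample {N : ℕ} {v : Fin N → RVec m} (hv : ∀ i, v i ∈ P.U) (y : P.Pair) :
    P.thetaH y ≤ P.thetaSample v y :=
  hamiltonianValue_mono fun _ hδ h => hδ.ae_signedSupport_add_subset
    (h.mono fun _ ht => ht.trans (Set.range_subset_iff.2 hv))

/-- Transfers upper bounds from `thetaSample` to `thetaNH` along recovery sequences, whose inputs
charge every sample. -/
theorem thetaNH_le_thetaSample {N : ℕ} {v : Fin N → RVec m} {y : P.Pair}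
    (hy : ∀ᵐ t, Set.range v ⊆ (y.2.kernel t).support) : P.thetaNH y ≤ P.thetaSample v y :=
  hamiltonianValue_mono fun _ _ h => by
    filter_upwards [h, hy] with t h1 h2 using h1.trans h2

theorem hamiltonianValue_nonpos {y : P.Pair} {C : (P.Time → SignedMeasure (RVec m)) → Prop}
    (hC : C fun _ => 0) : P.hamiltonianValue y C ≤ 0 := by
  have h0 : P.IsVariation y.2 fun _ => 0 :=
    ⟨fun B _ => measurable_const, .of_forall fun t => by
      rw [zero_add]; exact Measure.zero_le_toSignedMeasure _, .of_forall fun t => rfl⟩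
  refine (iInf₂_le _ ⟨h0, hC⟩).trans (le_of_eq ?_)
  have : ∀ t, P.hamiltonian t (y.1 t) 0 (P.costate y t) = 0 := fun t => by
    simp [hamiltonian, signedIntegral, SignedMeasure.toJordanDecomposition_zero]
  simp [this]

theorem thetaH_nonpos (y : P.Pair) : P.thetaH y ≤ 0 :=
  hamiltonianValue_nonpos (y.2.support_subset.mono fun t ht => by
    rwa [zero_add, signedSupport_toSignedMeasure])

theorem thetaSample_nonpos {N : ℕ} (v : Fin N → RVec m) (y : P.Pair) : P.thetaSample v y ≤ 0 :=
  hamiltonianValue_nonpos (.of_forall fun t => by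
    simp [signedSupport, SignedMeasure.totalVariation_zero])

/-! ### The optimality functions as infima of directional derivatives -/

namespace IsExtension

variable {F : P.Time × RVec n × RVec m → RVec n}
  {G : P.Time × RVec n × RVec m → (RVec n →L[ℝ] RVec n)} {L : ℝ}

theorem integral_hamiltonian (h : P.IsExtension F G L) (y : P.Pair) (μ' : P.RelaxedInput)
    {δ : P.Time → SignedMeasure (RVec m)} (hδ : ∀ᵐ t, δ t = variation y.2 μ' t) :
    ∫ t, P.hamiltonian t (y.1 t) (δ t) (P.costate y t) = descent F y μ' := by
  have hφ := h.isLipField_F.continuous_comp y.1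
  set φ : P.Time × RVec m → RVec n := fun q => F (q.1, y.1 q.1, q.2) with hφe
  refine integral_congr_ae ?_
  filter_upwards [hδ, y.2.ae_mem, μ'.ae_mem, y.2.ae_integrable (E := RVec n),
    μ'.ae_integrable (E := RVec n)] with t h1 h2 h3 h4 h5
  have a2 : P.f t (y.1 t) =ᵐ[y.2.kernel t] fun u => φ (t, u) :=
    h2.mono fun u hu => h.eq_F t (y.1 t) u hu
  have a3 : P.f t (y.1 t) =ᵐ[μ'.kernel t] fun u => φ (t, u) :=
    h3.mono fun u hu => h.eq_F t (y.1 t) u hu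
  rw [hamiltonian, h1, variation, signedIntegral_sub _ _ ((h5 φ hφ).congr a3.symm)
    ((h4 φ hφ).congr a2.symm), integral_congr_ae a2, integral_congr_ae a3]
  rfl

theorem thetaH_le_descent (h : P.IsExtension F G L) (y : P.Pair) (μ' : P.RelaxedInput) :
    P.thetaH y ≤ descent F y μ' := by
  rw [← h.integral_hamiltonian y μ' (.of_forall fun _ => rfl)]
  refine iInf₂_le (variation y.2 μ') ⟨isVariation_variation _ _, ?_⟩
  filter_upwards [μ'.support_subset] with t ht
  rwa [variation, sub_add_cancel, signedSupport_toSignedMeasure]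

theorem le_thetaH (h : P.IsExtension F G L) {y : P.Pair} {c : EReal}
    (hc : ∀ μ' : P.RelaxedInput, c ≤ descent F y μ') : c ≤ P.thetaH y := by
  refine le_iInf₂ fun δ hδ => ?_
  obtain ⟨μ', hμ'⟩ := hδ.1.exists_relaxedInput hδ.2
  rw [h.integral_hamiltonian y μ' hμ']
  exact hc μ'

theorem thetaSample_le_descent (h : P.IsExtension F G L) {N : ℕ} {v : Fin N → RVec m}
    {y : P.Pair} (hy : P.IsEmpirical v y.2) {μ' : P.RelaxedInput} (hμ' : P.IsEmpirical v μ') :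
    P.thetaSample v y ≤ descent F y μ' := by
  rw [← h.integral_hamiltonian y μ' (.of_forall fun _ => rfl)]
  exact iInf₂_le (variation y.2 μ')
    ⟨isVariation_variation _ _, signedSupport_variation_subset hy hμ'⟩

theorem le_thetaSample (h : P.IsExtension F G L) {N : ℕ} {v : Fin N → RVec m}
    (hv : ∀ i, v i ∈ P.U) {y : P.Pair} (hy : P.IsEmpirical v y.2) {c : EReal}
    (hc : ∀ μ' : P.RelaxedInput, P.IsEmpirical v μ' → c ≤ descent F y μ') :
    c ≤ P.thetaSample v y := by
  refine le_iInf₂ fun δ hδ => ?_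
  obtain ⟨μ', he, hμ'⟩ := hδ.1.exists_empirical hv hy hδ.2
  rw [h.integral_hamiltonian y μ' hμ']
  exact hc μ' he

end IsExtension

end ControlProblem

/-! ### Samples are almost surely dense in the limit -/

section Sampling

variable {m : ℕ} {Ω : Type*} [MeasurableSpace Ω] {Pr : Measure Ω}
  {ν : Measure (RVec m)} [IsProbabilityMeasure ν] {v : (N : ℕ) → Fin N → Ω → RVec m}

/-- All `N` samples miss `O` with probability `ν Oᶜ ^ N`, a convergent geometric series. The
direction of Borel–Cantelli used here needs no independence between different `N`. -/
theorem ae_eventually_exists_mem (hlaw : ∀ N i, HasLaw (v N i) ν Pr)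
    (hindep : ∀ N, iIndepFun (v N) Pr) {O : Set (RVec m)} (hO : MeasurableSet O)
    (hpos : ν O ≠ 0) : ∀ᵐ ω ∂Pr, ∀ᶠ N in atTop, ∃ i, v N i ω ∈ O := by
  have hq : ν Oᶜ < 1 := by
    rw [prob_compl_eq_one_sub hO]
    exact ENNReal.sub_lt_self ENNReal.one_ne_top one_ne_zero hpos
  have h : ∀ N, Pr {ω | ∀ i, v N i ω ∉ O} = ν Oᶜ ^ N := by
    intro N
    have h1 := (hindep N).measure_inter_preimage_eq_mul Finset.univ (sets := fun _ => Oᶜ)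
      fun i _ => hO.compl
    have h2 : ∀ i, Pr (v N i ⁻¹' Oᶜ) = ν Oᶜ := fun i =>
      (hlaw N i).measure_eq (p := fun x => x ∈ Oᶜ) hO.compl
    simp only [h2, Finset.prod_const, Finset.card_univ, Fintype.card_fin] at h1
    rw [← h1]
    congr 1
    ext ω
    simp
  have hsum : ∑' N, Pr {ω | ∀ i, v N i ω ∉ O} ≠ ⊤ := by
    simp_rw [h]
    rw [ENNReal.tsum_geometric]
    exact ENNReal.inv_ne_top.2 (tsub_pos_of_lt hq).ne'
  filter_upwards [ae_eventually_notMem hsum] with ω hω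
  filter_upwards [hω] with N hN
  simpa using hN

theorem ae_samples (hlaw : ∀ N i, HasLaw (v N i) ν Pr) (hindep : ∀ N, iIndepFun (v N) Pr) :
    ∀ᵐ ω ∂Pr, (∀ N i, v N i ω ∈ ν.support) ∧
      ∀ u ∈ ν.support, ∀ O ∈ 𝓝 u, ∀ᶠ N in atTop, ∃ i, v N i ω ∈ O := by
  have h1 : ∀ᵐ ω ∂Pr, ∀ N i, v N i ω ∈ ν.support := by
    refine ae_all_iff.2 fun N => ae_all_iff.2 fun i => ?_
    have hS : MeasurableSet ν.support := Measure.isClosed_support.measurableSet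
    exact ((hlaw N i).ae_iff (measurable_mem.2 hS)).2 Measure.support_mem_ae
  -- A countable basis allows one null set to serve all neighbourhoods.
  have h2 : ∀ᵐ ω ∂Pr, ∀ O ∈ TopologicalSpace.countableBasis (RVec m), ν O ≠ 0 →
      ∀ᶠ N in atTop, ∃ i, v N i ω ∈ O := by
    refine (ae_ball_iff (TopologicalSpace.countable_countableBasis _)).2 fun O hO => ?_
    by_cases h0 : ν O = 0
    · exact .of_forall fun ω h => absurd h0 h
    filter_upwards [ae_eventually_exists_mem hlaw hindep
      (TopologicalSpace.isOpen_of_mem_countableBasis hO).measurableSet h0] with ω hω _ using hω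
  filter_upwards [h1, h2] with ω hω1 hω2
  refine ⟨hω1, fun u hu O hO => ?_⟩
  obtain ⟨O', hO', huO', hsub⟩ :=
    (TopologicalSpace.isBasis_countableBasis (RVec m)).mem_nhds_iff.1 hO
  have hpos := (Measure.mem_support_iff_forall u).1 hu O'
    ((TopologicalSpace.isOpen_of_mem_countableBasis hO').mem_nhds huO')
  filter_upwards [hω2 O' hO' hpos.ne'] with N ⟨i, hi⟩
  exact ⟨i, hsub hi⟩

end Sampling

namespace ControlProblem

variable {n m : ℕ} {P : ControlProblem n m}

/-! ### Empirical inputs are dense in the limit -/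

/-- Push a relaxed input to the nearest samples and mix it with the uniform distribution. -/
theorem exists_empirical_near {N : ℕ} (hN : 0 < N) {v : Fin N → RVec m} (hv : ∀ i, v i ∈ P.U)
    (μ : P.RelaxedInput) : ∃ κ : P.RelaxedInput, P.IsEmpirical v κ ∧
      (∀ t, Set.range v ⊆ (κ.kernel t).support) ∧
      ∃ π : RVec m → RVec m, Measurable π ∧ (∀ x i, dist (π x) x ≤ dist (v i) x) ∧
        ∀ᵐ t, ∀ ψ : BoundedContinuousFunction (P.Time × RVec m) ℝ,
          |κ.avg ψ t - ∫ u, ψ (t, π u) ∂μ.kernel t| ≤ 1 / ((N : ℝ) + 1) * (2 * ‖ψ‖) := by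
  obtain ⟨ind, hind, hnear⟩ := exists_measurable_nearest hN v
  have hπ : Measurable (v ∘ ind) := (Measurable.of_discrete (f := v)).comp hind
  have hrU : P.Uᶜ ⊆ (Set.range v)ᶜ := Set.compl_subset_compl.2 (Set.range_subset_iff.2 hv)
  have hrm : MeasurableSet (Set.range v)ᶜ := (Set.finite_range v).measurableSet.compl
  have h1 : ∀ t, (μ.kernel.map (v ∘ ind)) t (Set.range v)ᶜ = 0 := fun t => by
    rw [Kernel.map_apply _ hπ, Measure.map_apply hπ hrm]
    have : v ∘ ind ⁻¹' (Set.range v)ᶜ = ∅ := by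
      ext x
      simp
    rw [this, measure_empty]
  let κ₁ : P.RelaxedInput := .ofKernel (μ.kernel.map (v ∘ ind))
    (Kernel.IsMarkovKernel.map _ hπ) (.of_forall fun t => measure_mono_null hrU (h1 t))
  have hκ₁ : P.IsEmpirical v κ₁ := isEmpirical_of_ae_compl_range hN (.of_forall h1)
  let ρ : Measure (RVec m) := (N : ENNReal)⁻¹ • ∑ i, Measure.dirac (v i)
  have hN0 : (N : ENNReal) ≠ 0 := by exact_mod_cast hN.ne'
  have hρ : IsProbabilityMeasure ρ := ⟨by
    simp only [ρ, Measure.smul_apply, Measure.coe_finsetSum, Finset.sum_apply, measure_univ,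
      Finset.sum_const, Finset.card_univ, Fintype.card_fin, smul_eq_mul, nsmul_eq_mul, mul_one]
    exact ENNReal.inv_mul_cancel hN0 (ENNReal.natCast_ne_top N)⟩
  have h2 : ρ (Set.range v)ᶜ = 0 := by
    simp [ρ, Measure.dirac_apply' _ hrm]
  let κ₂ : P.RelaxedInput := .ofKernel (Kernel.const _ ρ) inferInstance
    (.of_forall fun t => measure_mono_null hrU h2)
  have hκ₂ : P.IsEmpirical v κ₂ := isEmpirical_of_ae_compl_range hN (.of_forall fun t => h2)
  -- The share `1 / (N + 1)` of the uniform distribution is positive, so every sample is charged,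
  -- and it vanishes as `N` grows, so weak limits are unaffected.
  have hs0 : 0 < 1 / ((N : ℝ) + 1) := by positivity
  have hs1 : 1 / ((N : ℝ) + 1) ≤ 1 := by
    rw [div_le_one (by positivity)]
    linarith [N.cast_nonneg (α := ℝ)]
  refine ⟨κ₁.mix κ₂ _ hs0.le hs1, RelaxedInput.isEmpirical_mix hκ₁ hκ₂, fun t => ?_,
    v ∘ ind, hπ, hnear, ?_⟩
  · rintro _ ⟨i, rfl⟩
    have h3 : ρ ≪ (κ₁.mix κ₂ _ hs0.le hs1).kernel t := by
      refine Measure.AbsolutelyContinuous.mk fun s _ hs => ?_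
      rw [RelaxedInput.mix_kernel] at hs
      simp only [Measure.coe_add, Measure.coe_smul, Pi.add_apply, Pi.smul_apply, smul_eq_mul,
        add_eq_zero, mul_eq_zero, ENNReal.ofReal_eq_zero, not_le.2 hs0, false_or] at hs
      exact hs.2
    refine h3.support_mono ((Measure.mem_support_iff_forall _).2 fun O hO => ?_)
    have h4 : (1 : ENNReal) ≤ (∑ j, Measure.dirac (v j)) O := by
      rw [Measure.coe_finsetSum, Finset.sum_apply]
      refine le_trans ?_ (Finset.single_le_sum (f := fun j => Measure.dirac (v j) O)
        (fun j _ => zero_le) (Finset.mem_univ i))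
      simp [Measure.dirac_apply_of_mem (mem_of_mem_nhds hO)]
    exact ENNReal.mul_pos (ENNReal.inv_ne_zero.2 (ENNReal.natCast_ne_top N))
      (zero_lt_one.trans_le h4).ne'
  · filter_upwards [RelaxedInput.ae_avg_mix (μ := κ₁) (μ' := κ₂) (h0 := hs0.le) (h1 := hs1)
      (E := ℝ)] with t ht ψ
    have h3 : ∫ u, ψ (t, (v ∘ ind) u) ∂μ.kernel t = κ₁.avg ψ t := by
      change _ = ∫ u, ψ (t, u) ∂(μ.kernel.map (v ∘ ind)) t
      rw [Kernel.map_apply _ hπ, integral_map hπ.aemeasurable]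
      exact (ψ.continuous.comp (by fun_prop)).aestronglyMeasurable
    have hb : ∀ κ : P.RelaxedInput, |κ.avg ψ t| ≤ ‖ψ‖ := fun κ => by
      have := norm_integral_le_of_norm_le_const (μ := κ.kernel t) (f := fun u => ψ (t, u))
        (.of_forall fun u => ψ.norm_coe_le_norm (t, u))
      unfold RelaxedInput.avg
      simpa using this
    rw [h3, ht ψ ψ.continuous]
    have e : (1 - 1 / ((N : ℝ) + 1)) • κ₁.avg ψ t + (1 / ((N : ℝ) + 1)) • κ₂.avg ψ t - κ₁.avg ψ t
        = 1 / ((N : ℝ) + 1) * (κ₂.avg ψ t - κ₁.avg ψ t) := by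
      simp only [smul_eq_mul]; ring
    rw [e, abs_mul, abs_of_pos hs0]
    refine mul_le_mul_of_nonneg_left ((abs_sub _ _).trans ?_) hs0.le
    linarith [hb κ₁, hb κ₂]

/-- Density makes the nearest-sample maps converge to the identity pointwise on `U`. Dominated
convergence is applied in `u` for almost every `t` and then in `t`, so no uniform covering radius is
needed. -/
theorem exists_empirical_tendsto {v : (N : ℕ) → Fin N → RVec m} (hv : ∀ N i, v N i ∈ P.U)
    (hdense : ∀ u ∈ P.U, ∀ O ∈ 𝓝 u, ∀ᶠ N in atTop, ∃ i, v N i ∈ O) (μ : P.RelaxedInput) :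
    ∃ a : ℕ → P.RelaxedInput, (∀ N, 0 < N → P.IsEmpirical (v N) (a N) ∧
      ∀ t, Set.range (v N) ⊆ ((a N).kernel t).support) ∧ Tendsto a atTop (𝓝 μ) := by
  have h : ∀ N, ∃ κ : P.RelaxedInput, 0 < N → P.IsEmpirical (v N) κ ∧
      (∀ t, Set.range (v N) ⊆ (κ.kernel t).support) ∧
      ∃ π : RVec m → RVec m, Measurable π ∧ (∀ x i, dist (π x) x ≤ dist (v N i) x) ∧
        ∀ᵐ t, ∀ ψ : BoundedContinuousFunction (P.Time × RVec m) ℝ,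
          |κ.avg ψ t - ∫ u, ψ (t, π u) ∂μ.kernel t| ≤ 1 / ((N : ℝ) + 1) * (2 * ‖ψ‖) := by
    intro N
    rcases Nat.eq_zero_or_pos N with rfl | hN
    · exact ⟨μ, fun h => absurd h (lt_irrefl 0)⟩
    · obtain ⟨κ, hκ⟩ := exists_empirical_near hN (hv N) μ
      exact ⟨κ, fun _ => hκ⟩
  choose a ha using h
  refine ⟨a, fun N hN => ⟨(ha N hN).1, (ha N hN).2.1⟩, ?_⟩
  have hπ : ∀ N, ∃ π : RVec m → RVec m, 0 < N → Measurable π ∧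
      (∀ x i, dist (π x) x ≤ dist (v N i) x) ∧
        ∀ᵐ t, ∀ ψ : BoundedContinuousFunction (P.Time × RVec m) ℝ,
          |(a N).avg ψ t - ∫ u, ψ (t, π u) ∂μ.kernel t| ≤ 1 / ((N : ℝ) + 1) * (2 * ‖ψ‖) := by
    intro N
    rcases Nat.eq_zero_or_pos N with rfl | hN
    · exact ⟨id, fun h => absurd h (lt_irrefl 0)⟩
    · obtain ⟨π, hπ⟩ := (ha N hN).2.2
      exact ⟨π, fun _ => hπ⟩
  choose π hπ using hπ
  have hπu : ∀ u ∈ P.U, Tendsto (fun N => π N u) atTop (𝓝 u) := by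
    intro u hu
    rw [Metric.tendsto_nhds]
    intro ε hε
    filter_upwards [hdense u hu _ (Metric.ball_mem_nhds u hε), eventually_gt_atTop 0]
      with N ⟨i, hi⟩ hN
    exact ((hπ N hN).2.1 u i).trans_lt hi
  rw [RelaxedInput.tendsto_iff]
  intro ψ
  refine tendsto_integral_of_dominated_convergence (fun _ => ‖ψ‖)
    (fun N => ((a N).stronglyMeasurable_avg ψ.continuous).aestronglyMeasurable)
    (integrable_const _) (fun N => ?_) ?_
  · filter_upwards [(a N).ae_norm_avg_le (E := ℝ)] with t ht
    exact ht ψ _ fun u _ => ψ.norm_coe_le_norm (t, u)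
  have hall : ∀ᵐ t, ∀ N, 0 < N →
      |(a N).avg ψ t - ∫ u, ψ (t, π N u) ∂μ.kernel t| ≤ 1 / ((N : ℝ) + 1) * (2 * ‖ψ‖) := by
    rw [ae_all_iff]
    intro N
    by_cases hN : 0 < N
    · filter_upwards [(hπ N hN).2.2] with t ht _ using ht ψ
    · exact .of_forall fun t h => absurd h hN
  filter_upwards [hall, μ.ae_mem] with t ht htU
  have h1 : Tendsto (fun N => ∫ u, ψ (t, π N u) ∂μ.kernel t) atTop (𝓝 (μ.avg ψ t)) := by
    refine tendsto_integral_filter_of_dominated_convergence (fun _ => ‖ψ‖) ?_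
      (.of_forall fun N => .of_forall fun u => ψ.norm_coe_le_norm (t, π N u))
      (integrable_const _) ?_
    · filter_upwards [eventually_gt_atTop 0] with N hN
      exact (ψ.continuous.measurable.comp
        (measurable_const.prodMk (hπ N hN).1)).aestronglyMeasurable
    · filter_upwards [htU] with u hu
      exact (ψ.continuous.tendsto (t, u)).comp (tendsto_const_nhds.prodMk_nhds (hπu u hu))
  have h2 : Tendsto (fun N : ℕ => 1 / ((N : ℝ) + 1) * (2 * ‖ψ‖)) atTop (𝓝 0) := by
    simpa using tendsto_one_div_add_atTop_nhds_zero_nat.mul_const (2 * ‖ψ‖)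
  have h3 : Tendsto (fun N => (a N).avg ψ t - ∫ u, ψ (t, π N u) ∂μ.kernel t) atTop (𝓝 0) :=
    squeeze_zero_norm' ((eventually_gt_atTop 0).mono fun N hN => ht N hN) h2
  simpa using h3.add h1

/-! ### Continuity of the directional derivatives -/

namespace IsExtension

variable {F : P.Time × RVec n × RVec m → RVec n}
  {G : P.Time × RVec n × RVec m → (RVec n →L[ℝ] RVec n)} {L : ℝ}

/-- The Hamiltonian `p t • F (t, x t, u)` along a pair. -/
def hamiltonianAlong (F : P.Time × RVec n × RVec m → RVec n) (y : P.Pair)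
    (q : P.Time × RVec m) : ℝ :=
  inner ℝ (P.costate y q.1) (F (q.1, y.1 q.1, q.2))

theorem continuous_hamiltonianAlong (h : P.IsExtension F G L) (y : P.Pair) :
    Continuous (hamiltonianAlong F y) := by
  have hφ := h.isLipField_F.continuous_comp y.1
  exact Continuous.inner (by fun_prop) hφ

theorem descent_eq (h : P.IsExtension F G L) (y : P.Pair) (μ' : P.RelaxedInput) :
    descent F y μ' = (∫ t, μ'.avg (hamiltonianAlong F y) t)
      - ∫ t, y.2.avg (hamiltonianAlong F y) t := by
  have hφ := h.isLipField_F.continuous_comp y.1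
  have hH := h.continuous_hamiltonianAlong y
  rw [← integral_sub (μ'.integrable_avg hH) (y.2.integrable_avg hH), descent]
  refine integral_congr_ae ?_
  filter_upwards [μ'.ae_integrable (E := RVec n), y.2.ae_integrable (E := RVec n)] with t h1 h2
  rw [inner_sub_right]
  exact congrArg₂ _ (integral_inner (h1 _ hφ) _).symm (integral_inner (h2 _ hφ) _).symm

theorem tendsto_descent (h : P.IsExtension F G L) (y : P.Pair) {ι : Type*} {l : Filter ι}
    {b : ι → P.RelaxedInput} {μ' : P.RelaxedInput} (hb : Tendsto b l (𝓝 μ')) :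
    Tendsto (fun j => descent F y (b j)) l (𝓝 (descent F y μ')) := by
  simp_rw [h.descent_eq]
  have := RelaxedInput.tendsto_setIntegral_avg_real hb MeasurableSet.univ
    (h.continuous_hamiltonianAlong y)
  simp only [Measure.restrict_univ] at this
  exact this.sub_const _

/-- The bound `η` is uniform in the direction, which is what infima require. The Hamiltonians
converge uniformly on `[0, T] × U`, and averaging against any relaxed input preserves this; weak
convergence enters only through the base input. -/
theorem exists_abs_descent_sub_le (h : P.IsExtension F G L) {ι : Type*} {l : Filter ι}
    {a : ι → P.Pair} {y : P.Pair} (ha : Tendsto a l (𝓝 y)) :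
    ∃ η : ι → ℝ, Tendsto η l (𝓝 0) ∧
      ∀ j μ', |descent F (a j) μ' - descent F y μ'| ≤ η j := by
  have hp := tendsto_iff_norm_sub_tendsto_zero.1 (h.tendsto_costate ha)
  obtain ⟨hx, hμ⟩ := Prod.tendsto_iff a y |>.1 ha
  replace hx := tendsto_iff_norm_sub_tendsto_zero.1 hx
  have hH := h.continuous_hamiltonianAlong y
  obtain ⟨B, hB0, hB⟩ := P.exists_bound_of_continuous (h.isLipField_F.continuous_comp y.1)
  set V := volume.real (Set.univ : Set P.Time) with hV
  set ε : ι → ℝ := fun j => ‖P.costate (a j) - P.costate y‖ * (B + L * ‖(a j).1 - y.1‖)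
    + ‖P.costate y‖ * (L * ‖(a j).1 - y.1‖) with hε
  have hε0 : Tendsto ε l (𝓝 0) := by
    simpa using (hp.mul ((hx.const_mul L).const_add B)).add
      ((hx.const_mul L).const_mul ‖P.costate y‖)
  have hεH : ∀ j t, ∀ u ∈ P.U,
      ‖hamiltonianAlong F (a j) (t, u) - hamiltonianAlong F y (t, u)‖ ≤ ε j := by
    intro j t u hu
    have b1 := (P.costate (a j) - P.costate y).norm_coe_le_norm t
    have b2 := (P.costate y).norm_coe_le_norm t
    have b3 : ‖F (t, (a j).1 t, u) - F (t, y.1 t, u)‖ ≤ L * ‖(a j).1 - y.1‖ :=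
      (h.lip_F _ _ _ u hu).trans
        (mul_le_mul_of_nonneg_left (((a j).1 - y.1).norm_coe_le_norm t) h.pos.le)
    have b4 : ‖F (t, (a j).1 t, u)‖ ≤ B + L * ‖(a j).1 - y.1‖ := by
      calc _ = ‖F (t, y.1 t, u) + (F (t, (a j).1 t, u) - F (t, y.1 t, u))‖ := by
            congr 1; abel
        _ ≤ _ := (norm_add_le _ _).trans (add_le_add (hB t u hu) b3)
    have e : hamiltonianAlong F (a j) (t, u) - hamiltonianAlong F y (t, u)
        = inner ℝ ((P.costate (a j) - P.costate y) t) (F (t, (a j).1 t, u))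
          + inner ℝ (P.costate y t) (F (t, (a j).1 t, u) - F (t, y.1 t, u)) := by
      simp only [hamiltonianAlong, ContinuousMap.sub_apply, inner_sub_left, inner_sub_right]
      ring
    rw [e]
    refine (norm_add_le _ _).trans (add_le_add ?_ ?_)
    · exact (norm_inner_le_norm _ _).trans (mul_le_mul b1 b4 (norm_nonneg _) (norm_nonneg _))
    · exact (norm_inner_le_norm _ _).trans (mul_le_mul b2 b3 (norm_nonneg _) (norm_nonneg _))
  have hint : ∀ j (κ : P.RelaxedInput), |(∫ t, κ.avg (hamiltonianAlong F (a j)) t)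
      - ∫ t, κ.avg (hamiltonianAlong F y) t| ≤ ε j * V := by
    intro j κ
    have hHj := h.continuous_hamiltonianAlong (a j)
    rw [← integral_sub (κ.integrable_avg hHj) (κ.integrable_avg hH), ← Real.norm_eq_abs]
    refine norm_integral_le_of_norm_le_const ?_
    filter_upwards [κ.ae_norm_avg_sub_avg_le (E := ℝ)] with t ht
    exact ht _ _ hHj hH (ε j) (hεH j t)
  have hw := RelaxedInput.tendsto_setIntegral_avg_real hμ MeasurableSet.univ hH
  simp only [Measure.restrict_univ] at hw
  rw [tendsto_iff_norm_sub_tendsto_zero] at hw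
  refine ⟨fun j => ε j * V + ε j * V + ‖(∫ t, (a j).2.avg (hamiltonianAlong F y) t)
    - ∫ t, y.2.avg (hamiltonianAlong F y) t‖, ?_, fun j μ' => ?_⟩
  · simpa using ((hε0.mul_const V).add (hε0.mul_const V)).add hw
  · rw [h.descent_eq, h.descent_eq]
    have c1 := abs_le.1 (hint j μ')
    have c2 := abs_le.1 (hint j (a j).2)
    have c3 := abs_le.1 (Real.norm_eq_abs ((∫ t, (a j).2.avg (hamiltonianAlong F y) t)
      - ∫ t, y.2.avg (hamiltonianAlong F y) t)).ge
    rw [abs_le]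
    constructor <;> linarith [c1.1, c1.2, c2.1, c2.2, c3.1, c3.2]

/-! ### Semicontinuity of the optimality functions -/

theorem exists_le_descent (h : P.IsExtension F G L) (y : P.Pair) :
    ∃ c : ℝ, ∀ μ', c ≤ descent F y μ' := by
  have hH := h.continuous_hamiltonianAlong y
  obtain ⟨B, hB0, hB⟩ := P.exists_bound_of_continuous hH
  have hint : ∀ κ : P.RelaxedInput, |∫ t, κ.avg (hamiltonianAlong F y) t|
      ≤ B * volume.real (Set.univ : Set P.Time) := fun κ => by
    rw [← Real.norm_eq_abs]
    refine norm_integral_le_of_norm_le_const ?_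
    filter_upwards [κ.ae_norm_avg_le (E := ℝ)] with t ht using ht _ B (hB t)
  refine ⟨-(2 * (B * volume.real (Set.univ : Set P.Time))), fun μ' => ?_⟩
  rw [h.descent_eq]
  linarith [(abs_le.1 (hint μ')).1, (abs_le.1 (hint y.2)).2]

theorem thetaH_ne_bot (h : P.IsExtension F G L) (y : P.Pair) : P.thetaH y ≠ ⊥ := by
  obtain ⟨c, hc⟩ := h.exists_le_descent y
  exact ne_bot_of_le_ne_bot (EReal.coe_ne_bot c)
    (h.le_thetaH fun μ' => EReal.coe_le_coe_iff.2 (hc μ'))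

theorem thetaH_le_liminf (h : P.IsExtension F G L) {a : ℕ → P.Pair} {y : P.Pair}
    (ha : Tendsto a atTop (𝓝 y)) : P.thetaH y ≤ liminf (fun j => P.thetaH (a j)) atTop := by
  obtain ⟨η, hη, hd⟩ := h.exists_abs_descent_sub_le ha
  refine le_of_forall_lt fun c hc => ?_
  obtain ⟨r', hcr, hr'⟩ := EReal.lt_iff_exists_real_btwn.1 hc
  obtain ⟨r, hr, hrθ⟩ := EReal.lt_iff_exists_real_btwn.1 hr'
  -- The gap between `r'` and `r` absorbs the error `η j`.
  refine hcr.trans_le (le_liminf_of_le (by isBoundedDefault) ?_)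
  have hrr : 0 < r - r' := sub_pos.2 (EReal.coe_lt_coe_iff.1 hr)
  filter_upwards [hη.eventually (gt_mem_nhds hrr)] with j hj
  refine h.le_thetaH fun μ' => EReal.coe_le_coe_iff.2 ?_
  have h1 : r ≤ descent F y μ' :=
    EReal.coe_le_coe_iff.1 (hrθ.le.trans (h.thetaH_le_descent y μ'))
  linarith [(abs_le.1 (hd j μ')).1]

/-- Each competitor `μ'` in the infimum is approximated by empirical inputs `b (k j)`. These are
admissible at `a j` whatever its weights, because variations may move mass to any sample. Continuity
of `descent` then bounds the limsup by the value at `μ'`. -/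
theorem limsup_thetaSample_le (h : P.IsExtension F G L) {v : (N : ℕ) → Fin N → RVec m}
    (hv : ∀ N i, v N i ∈ P.U)
    (hdense : ∀ u ∈ P.U, ∀ O ∈ 𝓝 u, ∀ᶠ N in atTop, ∃ i, v N i ∈ O) {k : ℕ → ℕ}
    (hk : Tendsto k atTop atTop) {a : ℕ → P.Pair} {y : P.Pair} (ha : Tendsto a atTop (𝓝 y))
    (hae : ∀ᶠ j in atTop, P.IsEmpirical (v (k j)) (a j).2) :
    limsup (fun j => P.thetaSample (v (k j)) (a j)) atTop ≤ P.thetaH y := by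
  obtain ⟨η, hη, hd⟩ := h.exists_abs_descent_sub_le ha
  refine h.le_thetaH fun μ' => ?_
  obtain ⟨b, hb, hbμ⟩ := exists_empirical_tendsto hv hdense μ'
  have h1 : Tendsto (fun j => descent F y (b (k j)) + η j) atTop (𝓝 (descent F y μ' + 0)) :=
    (h.tendsto_descent y (hbμ.comp hk)).add hη
  rw [add_zero] at h1
  have h2 := ((continuous_coe_real_ereal.tendsto _).comp h1).limsup_eq
  rw [← h2]
  refine limsup_le_limsup ?_ (by isBoundedDefault) (by isBoundedDefault)
  filter_upwards [hae] with j hj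
  refine (h.thetaSample_le_descent hj (hb (k j) hj.pos).1).trans (EReal.coe_le_coe_iff.2 ?_)
  linarith [(abs_le.1 (hd j (b (k j)))).2]

/-! ### Epi-convergence -/

theorem exists_recovery (h : P.IsExtension F G L) {v : (N : ℕ) → Fin N → RVec m}
    (hv : ∀ N i, v N i ∈ P.U)
    (hdense : ∀ u ∈ P.U, ∀ O ∈ 𝓝 u, ∀ᶠ N in atTop, ∃ i, v N i ∈ O) {y : P.Pair}
    (hy : y ∈ P.relaxedPairs) : ∃ a : ℕ → P.Pair, (∀ᶠ N in atTop, a N ∈ P.empiricalPairs (v N)) ∧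
      Tendsto a atTop (𝓝 y) ∧ ∀ᶠ N in atTop, P.thetaNH (a N) ≤ P.thetaSample (v N) (a N) := by
  obtain ⟨b, hb, hbμ⟩ := exists_empirical_tendsto hv hdense y.2
  choose x hx _ using fun N => h.existsUnique_trajectory (b N)
  refine ⟨fun N => (x N, b N), ?_, ?_, ?_⟩
  · filter_upwards [eventually_gt_atTop 0] with N hN using ⟨hx N, (hb N hN).1⟩
  · exact (h.tendsto_trajectory hbμ hx hy).prodMk_nhds hbμ
  · filter_upwards [eventually_gt_atTop 0] with N hN
    exact thetaNH_le_thetaSample (.of_forall (hb N hN).2)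

theorem tendsto_cost (h : P.IsExtension F G L) {a : ℕ → P.Pair} {y : P.Pair}
    (ha : Tendsto a atTop (𝓝 y)) : Tendsto (fun j => P.cost (a j)) atTop (𝓝 (P.cost y)) := by
  have hx : Continuous fun z : P.Pair => P.Ψ (z.1 P.finalTime) :=
    h.continuous_cost.comp ((continuous_eval_const P.finalTime).comp continuous_fst)
  exact ((continuous_coe_real_ereal.comp hx).tendsto y).comp ha

theorem epiConverges_thetaNH (h : P.IsExtension F G L) {v : (N : ℕ) → Fin N → RVec m}
    (hv : ∀ N i, v N i ∈ P.U)
    (hdense : ∀ u ∈ P.U, ∀ O ∈ 𝓝 u, ∀ᶠ N in atTop, ∃ i, v N i ∈ O) :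
    EpiConverges (fun N => P.empiricalPairs (v N)) (fun _ => P.thetaNH) P.relaxedPairs P.thetaH where
  recovery y hy := by
    obtain ⟨a, haD, ha, hle⟩ := h.exists_recovery hv hdense hy
    exact ⟨a, haD, ha, (limsup_le_limsup hle (by isBoundedDefault) (by isBoundedDefault)).trans
      (h.limsup_thetaSample_le hv hdense tendsto_id ha (haD.mono fun N hN => hN.2))⟩
  lower k _ a y haD ha :=
    ⟨h.isTrajectory_of_tendsto ha fun j => (haD j).1, (h.thetaH_le_liminf ha).trans
      (liminf_le_liminf (.of_forall fun j => thetaH_le_thetaNH (a j))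
        (by isBoundedDefault) (by isBoundedDefault))⟩

theorem epiConverges_thetaSample (h : P.IsExtension F G L) {v : (N : ℕ) → Fin N → RVec m}
    (hv : ∀ N i, v N i ∈ P.U)
    (hdense : ∀ u ∈ P.U, ∀ O ∈ 𝓝 u, ∀ᶠ N in atTop, ∃ i, v N i ∈ O) :
    EpiConverges (fun N => P.empiricalPairs (v N)) (fun N => P.thetaSample (v N))
      P.relaxedPairs P.thetaH where
  recovery y hy := by
    obtain ⟨a, haD, ha, -⟩ := h.exists_recovery hv hdense hy
    exact ⟨a, haD, ha,
      h.limsup_thetaSample_le hv hdense tendsto_id ha (haD.mono fun N hN => hN.2)⟩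
  lower k _ a y haD ha :=
    ⟨h.isTrajectory_of_tendsto ha fun j => (haD j).1, (h.thetaH_le_liminf ha).trans
      (liminf_le_liminf (.of_forall fun j => thetaH_le_thetaSample (hv (k j)) (a j))
        (by isBoundedDefault) (by isBoundedDefault))⟩

theorem epiConverges_cost (h : P.IsExtension F G L) {v : (N : ℕ) → Fin N → RVec m}
    (hv : ∀ N i, v N i ∈ P.U)
    (hdense : ∀ u ∈ P.U, ∀ O ∈ 𝓝 u, ∀ᶠ N in atTop, ∃ i, v N i ∈ O) :
    EpiConverges (fun N => P.empiricalPairs (v N)) (fun _ => P.cost) P.relaxedPairs P.cost where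
  recovery y hy := by
    obtain ⟨a, haD, ha, -⟩ := h.exists_recovery hv hdense hy
    exact ⟨a, haD, ha, (h.tendsto_cost ha).limsup_eq.le⟩
  lower k _ a y haD ha :=
    ⟨h.isTrajectory_of_tendsto ha fun j => (haD j).1, (h.tendsto_cost ha).liminf_eq.ge⟩

/-! ### Optimality functions -/

theorem isOptimalityFunction_thetaH (h : P.IsExtension F G L) :
    IsOptimalityFunction P.relaxedPairs P.cost P.thetaH where
  nonpos y _ := thetaH_nonpos y
  ne_bot y _ := h.thetaH_ne_bot y
  eq_zero y hy hmin := by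
    refine le_antisymm (thetaH_nonpos y) (h.le_thetaH fun μ' => EReal.coe_nonneg.2 ?_)
    exact h.descent_nonneg hy μ' fun ε h0 h1 x hx =>
      EReal.coe_le_coe_iff.1 (isMinOn_iff.1 hmin (x, y.2.mix μ' ε h0 h1) hx)

/-- Finiteness is inherited from `thetaH`, which lies below. Vanishing at minimizers follows from
the first-order condition along segments to empirical inputs. -/
theorem isOptimalityFunction_thetaSample (h : P.IsExtension F G L) {N : ℕ} {v : Fin N → RVec m}
    (hv : ∀ i, v i ∈ P.U) :
    IsOptimalityFunction (P.empiricalPairs v) P.cost (P.thetaSample v) where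
  nonpos y _ := thetaSample_nonpos v y
  ne_bot y _ := ne_bot_of_le_ne_bot (h.thetaH_ne_bot y) (thetaH_le_thetaSample hv y)
  eq_zero y hy hmin := by
    refine le_antisymm (thetaSample_nonpos v y)
      (h.le_thetaSample hv hy.2 fun μ' hμ' => EReal.coe_nonneg.2 ?_)
    exact h.descent_nonneg hy.1 μ' fun ε h0 h1 x hx => EReal.coe_le_coe_iff.1
      (isMinOn_iff.1 hmin (x, y.2.mix μ' ε h0 h1)
        ⟨hx, RelaxedInput.isEmpirical_mix (h0 := h0) (h1 := h1) hy.2 hμ'⟩)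

theorem consistentApproximations (h : P.IsExtension F G L) {v : (N : ℕ) → Fin N → RVec m}
    (hv : ∀ N i, v N i ∈ P.U)
    (hdense : ∀ u ∈ P.U, ∀ O ∈ 𝓝 u, ∀ᶠ N in atTop, ∃ i, v N i ∈ O) :
    ConsistentApproximations (fun N => P.empiricalPairs (v N)) (fun _ => P.cost)
      (fun N => P.thetaSample (v N)) P.relaxedPairs P.cost P.thetaH where
  optimality_approx N := h.isOptimalityFunction_thetaSample (hv N)
  optimality_limit := h.isOptimalityFunction_thetaH
  epi := h.epiConverges_cost hv hdense
  upper _ hk _ _ haD ha :=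
    h.limsup_thetaSample_le hv hdense hk.tendsto_atTop ha (.of_forall fun j => (haD j).2)

end IsExtension

end ControlProblem

end

theorem mainTheorem3 {n m : ℕ} (P : ControlProblem n m) (hP : P.LipschitzC1)
    {Ω : Type*} [MeasurableSpace Ω] (Pr : Measure Ω) [IsProbabilityMeasure Pr]
    (ν : Measure (RVec m)) [IsProbabilityMeasure ν] (hν : ν.support = P.U)
    (v : (N : ℕ) → Fin N → Ω → RVec m)
    (hlaw : ∀ N i, HasLaw (v N i) ν Pr) (hindep : ∀ N, iIndepFun (v N) Pr) :
    (∀ μ : P.RelaxedInput, ∃! x, P.IsTrajectory x μ) ∧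
    (∀ y : P.Pair, ∃! p, P.IsCostate y p) ∧
    ∀ᵐ ω ∂Pr,
      EpiConverges (fun N => P.empiricalPairs fun i => v N i ω) (fun _ => P.thetaNH)
        P.relaxedPairs P.thetaH ∧
      EpiConverges (fun N => P.empiricalPairs fun i => v N i ω)
        (fun N => P.thetaSample fun i => v N i ω) P.relaxedPairs P.thetaH ∧
      ConsistentApproximations (fun N => P.empiricalPairs fun i => v N i ω)
        (fun _ => P.cost) (fun N => P.thetaSample fun i => v N i ω)
        P.relaxedPairs P.cost P.thetaH := by
  obtain ⟨F, G, L, h⟩ := hP.exists_extension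
  refine ⟨h.existsUnique_trajectory, h.existsUnique_costate, ?_⟩
  have hs := ae_samples hlaw hindep
  rw [hν] at hs
  filter_upwards [hs] with ω hω
  exact ⟨h.epiConverges_thetaNH hω.1 hω.2, h.epiConverges_thetaSample hω.1 hω.2,
    h.consistentApproximations hω.1 hω.2⟩
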